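/- Graphs are finite and may have loops and parallel edges. For a graph $G$ and $X\subseteq E(G)$ let $G\langle X\rangle$ be the subgraph with edge set $X$ whose vertices are the ends of the edges in $X$, and let $\Delta(G)=|E(G)|-|V(G)|$. For $k\ge 1$, the *$k$-circular matroid* $M_k(G)$ is the matroid on $E(G)$ whose circuits are the sets $C\subseteq E(G)$ such that $\Delta(G\langle C\rangle)=k$ and $G\langle C\rangle$ has no isolated vertices, no leaves (vertices of degree $1$, a loop contributing $2$ to the degree) and no component that is a cycle (a loop and a pair of parallel edges being cycles). Let $\rho^*_k(G)$ be the corank of $M_k(G)$, i.e. the rank of its dual, and let $s(x,G)$ be the number of edges incident to the vertex $x$. The vertex $x$ is *$k$-small* if $s(x,G)<\rho^*_k(G)+1$ and *$k$-tight* if $s(x,G)=\rho^*_k(G)+1$. Graphs $G$, $G'$ with the same edge set are *strongly isomorphic* if there is a bijection $\nu:V(G)\to V(G')$ such that an edge has ends $x,y$ in $G$ if and only if it has ends $\nu(x),\nu(y)$ in $G'$. The graph $G$ is *uniquely defined by* $M_k(G)$ if every graph $G'$ without isolated vertices such that $M_k(G')=M_k(G)$ is strongly isomorphic to $G$. **Theorem.**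 Let $k\ge 1$ and let $G$ be a $3$-connected graph, i.e. $G$ has no loops (parallel edges are allowed), has at least four vertices, and stays connected after deletion of any at most two vertices. Then the following are equivalent: (c1) $G$ is uniquely defined by $M_k(G)$; (c2) $|E(G)|-|V(G)|\ge k$, and either every vertex of $G$ is $k$-small, or there is a $k$-tight vertex $t$ of $G$ such that every other vertex of $G$ is $k$-small. -/

import Mathlib

open Graph

universe u v

namespace KCircular

variable {α : Type u} {β : Type v}

/-- The subgraph `G⟨X⟩` induced by a set `X` of edges: its edges are those in `X`, its vertices are
the ends of the edges in `X`. -/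
def edgeInduce (G : Graph α β) (X : Set β) : Graph α β where
  vertexSet := {x | ∃ e ∈ X, G.Inc e x}
  edgeSet := E(G) ∩ X
  IsLink e x y := e ∈ X ∧ G.IsLink e x y
  isLink_symm _ _ := ⟨fun _ _ h => ⟨h.1, h.2.symm⟩⟩
  eq_or_eq_of_isLink_of_isLink _ _ _ _ _ h h' := h.2.left_eq_or_eq h'.2
  edge_mem_iff_exists_isLink e :=
    ⟨fun h => by
      obtain ⟨x, y, hxy⟩ := G.exists_isLink_of_mem_edgeSet h.1
      exact ⟨x, y, h.2, hxy⟩,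
    fun ⟨_, _, h⟩ => ⟨h.2.edge_mem, h.1⟩⟩
  left_mem_of_isLink _ _ _ h := ⟨_, h.1, h.2.inc_left⟩

/-- `Δ(G) = |E(G)| - |V(G)|` (for a finite graph). -/
noncomputable def excess (G : Graph α β) : ℤ := (E(G).ncard : ℤ) - (V(G).ncard : ℤ)

/-- The degree of a vertex, where a loop counts twice. -/
noncomputable def deg (G : Graph α β) (x : α) : ℕ := (G.incidenceSet x).ncard + (G.loopSet x).ncard

/-- Every vertex is incident to an edge. -/
def NoIsolatedVertex (G : Graph α β) : Prop := ∀ x ∈ V(G), ∃ e, G.Inc e x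

/-- A leaf is a vertex of degree one. -/
def NoLeaf (G : Graph α β) : Prop := ∀ x ∈ V(G), deg G x ≠ 1

/-- A graph is connected if it is nonempty and any two vertices are joined by a path; loops and
parallel edges are irrelevant, so this is connectedness of the underlying simple graph. -/
def IsConnected (G : Graph α β) : Prop := G.toSimpleGraph.Connected

/-- A cycle (possibly with one or two vertices): a finite connected graph all of whose vertices
have degree two. -/
def IsCycleGraph (G : Graph α β) : Prop :=
  V(G).Finite ∧ IsConnected G ∧ ∀ x ∈ V(G), deg G x = 2

/-- No component is a cycle. (`H ≤c G` says that `H` is a union of components of `G`, so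
a connected such `H` is a component.) -/
def NoCycleComponent (G : Graph α β) : Prop := ∀ H : Graph α β, H ≤c G → ¬ IsCycleGraph H

/-- Cacti-graphs: no isolated vertices, no leaves, no cycle components. -/
def IsCactiGraph (G : Graph α β) : Prop :=
  NoIsolatedVertex G ∧ NoLeaf G ∧ NoCycleComponent G

/-- The family `C_k(G)` of the edge sets `C` such that `Δ(G⟨C⟩) = k` and `G⟨C⟩` is a
cacti-graph. -/
def kCircuits (G : Graph α β) (k : ℕ) : Set (Set β) :=
  {C | C ⊆ E(G) ∧ excess (edgeInduce G C) = k ∧ IsCactiGraph (edgeInduce G C)}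

/-! Auxiliary facts: `C_k(G)` is the family of circuits of a matroid. -/

theorem edgeInduce_inc {G : Graph α β} {X : Set β} {e : β} {x : α} :
    (edgeInduce G X).Inc e x ↔ e ∈ X ∧ G.Inc e x :=
  ⟨fun ⟨y, h⟩ => ⟨h.1, y, h.2⟩, fun ⟨h, y, hy⟩ => ⟨y, h, hy⟩⟩

theorem mem_vertexSet_edgeInduce {G : Graph α β} {X : Set β} {x : α} :
    x ∈ V(edgeInduce G X) ↔ ∃ e ∈ X, G.Inc e x := Iff.rfl

theorem edgeSet_edgeInduce {G : Graph α β} {X : Set β} (hX : X ⊆ E(G)) :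
    E(edgeInduce G X) = X := Set.inter_eq_right.2 hX

theorem ends_finite (G : Graph α β) (e : β) : {x | G.Inc e x}.Finite := by
  by_cases he : e ∈ E(G)
  · obtain ⟨x, y, h⟩ := G.exists_isLink_of_mem_edgeSet he
    refine (Set.toFinite {x, y}).subset fun z hz => ?_
    simpa using Graph.Inc.eq_or_eq_of_isLink hz h
  · convert Set.finite_empty
    ext x
    simpa using fun h : G.Inc e x => he h.edge_mem

theorem vertexSet_edgeInduce_finite (G : Graph α β) {X : Set β} (hX : X.Finite) :
    V(edgeInduce G X).Finite := by
  have : V(edgeInduce G X) = ⋃ e ∈ X, {x | G.Inc e x} := by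
    ext x; simp [mem_vertexSet_edgeInduce]
  rw [this]
  exact hX.biUnion fun e _ => ends_finite G e

theorem vertexSet_edgeInduce_mono (G : Graph α β) {X Y : Set β} (h : X ⊆ Y) :
    V(edgeInduce G X) ⊆ V(edgeInduce G Y) := fun _ ⟨e, he, hx⟩ => ⟨e, h he, hx⟩

theorem vertexSet_edgeInduce_union (G : Graph α β) (X Y : Set β) :
    V(edgeInduce G (X ∪ Y)) = V(edgeInduce G X) ∪ V(edgeInduce G Y) := by
  ext x
  simp only [mem_vertexSet_edgeInduce, Set.mem_union]
  constructor
  · rintro ⟨e, he | he, hx⟩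
    exacts [Or.inl ⟨e, he, hx⟩, Or.inr ⟨e, he, hx⟩]
  · rintro (⟨e, he, hx⟩ | ⟨e, he, hx⟩)
    exacts [⟨e, Or.inl he, hx⟩, ⟨e, Or.inr he, hx⟩]

theorem excess_edgeInduce {G : Graph α β} {X : Set β} (hX : X ⊆ E(G)) :
    excess (edgeInduce G X) = (X.ncard : ℤ) - (V(edgeInduce G X).ncard : ℤ) := by
  rw [excess, edgeSet_edgeInduce hX]

theorem excess_supermodular {G : Graph α β} (hE : E(G).Finite) {X Y : Set β} (hX : X ⊆ E(G))
    (hY : Y ⊆ E(G)) :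
    excess (edgeInduce G X) + excess (edgeInduce G Y) ≤
      excess (edgeInduce G (X ∪ Y)) + excess (edgeInduce G (X ∩ Y)) := by
  have fX := hE.subset hX
  have fY := hE.subset hY
  rw [excess_edgeInduce hX, excess_edgeInduce hY, excess_edgeInduce (Set.union_subset hX hY),
    excess_edgeInduce (Set.inter_subset_left.trans hX), vertexSet_edgeInduce_union]
  have h1 := Set.ncard_union_add_ncard_inter X Y fX fY
  have h2 := Set.ncard_union_add_ncard_inter V(edgeInduce G X) V(edgeInduce G Y)
    (vertexSet_edgeInduce_finite G fX) (vertexSet_edgeInduce_finite G fY)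
  have h3 : V(edgeInduce G (X ∩ Y)).ncard ≤ (V(edgeInduce G X) ∩ V(edgeInduce G Y)).ncard :=
    Set.ncard_le_ncard (Set.subset_inter (vertexSet_edgeInduce_mono G Set.inter_subset_left)
      (vertexSet_edgeInduce_mono G Set.inter_subset_right))
      ((vertexSet_edgeInduce_finite G fX).inter_of_left _)
  omega

open Classical in
/-- Double counting of the incidences between a set of vertices and the edges. -/
theorem sum_deg {H : Graph α β} (hE : E(H).Finite) (N : Finset α) :
    ∑ x ∈ N, deg H x = ∑ e ∈ hE.toFinset,
      ((N.filter fun x => H.Inc e x).card + (N.filter fun x => H.IsLoopAt e x).card) := by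
  have h1 : ∀ x, (H.incidenceSet x).ncard = (hE.toFinset.filter fun e => H.Inc e x).card := by
    intro x
    rw [← Set.ncard_coe_finset]
    congr 1
    ext e
    simpa using fun h : H.Inc e x => h.edge_mem
  have h2 : ∀ x, (H.loopSet x).ncard = (hE.toFinset.filter fun e => H.IsLoopAt e x).card := by
    intro x
    rw [← Set.ncard_coe_finset]
    congr 1
    ext e
    simpa using fun h : H.IsLoopAt e x => h.edge_mem
  simp only [deg, h1, h2, Finset.sum_add_distrib]
  congr 1 <;> exact Finset.sum_card_bipartiteAbove_eq_sum_card_bipartiteBelow _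

open Classical in
theorem ends_count_le {H : Graph α β} (N : Finset α) {e : β} (he : e ∈ E(H)) :
    (N.filter fun x => H.Inc e x).card + (N.filter fun x => H.IsLoopAt e x).card ≤ 2 := by
  obtain ⟨x, y, h⟩ := H.exists_isLink_of_mem_edgeSet he
  by_cases hxy : x = y
  · subst hxy
    have h1 : (N.filter fun z => H.Inc e z) ⊆ {x} := fun z hz => by
      have := (Finset.mem_filter.1 hz).2.eq_or_eq_of_isLink h
      simpa using this
    have h2 : (N.filter fun z => H.IsLoopAt e z) ⊆ {x} := fun z hz => by
      have := (Finset.mem_filter.1 hz).2.inc.eq_or_eq_of_isLink h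
      simpa using this
    have := Finset.card_le_card h1
    have := Finset.card_le_card h2
    simp at *
    omega
  · have h1 : (N.filter fun z => H.Inc e z) ⊆ {x, y} := fun z hz => by
      have := (Finset.mem_filter.1 hz).2.eq_or_eq_of_isLink h
      simpa using this
    have h2 : (N.filter fun z => H.IsLoopAt e z) = ∅ := by
      refine Finset.filter_eq_empty_iff.2 fun z _ hz => hxy ?_
      rw [← hz.eq_of_inc h.inc_left, ← hz.eq_of_inc h.inc_right]
    have := (Finset.card_le_card h1).trans Finset.card_le_two
    rw [h2]
    simpa using this

open Classical in
theorem ends_count_lt {H : Graph α β} (N : Finset α) {e : β} {z : α} (hz : H.Inc e z)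
    (hzN : z ∉ N) :
    (N.filter fun x => H.Inc e x).card + (N.filter fun x => H.IsLoopAt e x).card < 2 := by
  obtain ⟨y, h⟩ := hz
  have h1 : (N.filter fun x => H.Inc e x) ⊆ {y} := fun x hx => by
    rw [Finset.mem_filter] at hx
    rcases hx.2.eq_or_eq_of_isLink h with rfl | rfl
    · exact absurd hx.1 hzN
    · simp
  have h2 : (N.filter fun x => H.IsLoopAt e x) = ∅ := by
    refine Finset.filter_eq_empty_iff.2 fun x hx hl => hzN ?_
    rwa [← hl.eq_of_inc h.inc_left]
  have := Finset.card_le_card h1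
  rw [h2]
  simp at *
  omega

open Classical in
theorem ends_count_eq {H : Graph α β} (N : Finset α) {e : β} (he : e ∈ E(H))
    (hN : ∀ x, H.Inc e x → x ∈ N) :
    2 ≤ (N.filter fun x => H.Inc e x).card + (N.filter fun x => H.IsLoopAt e x).card := by
  obtain ⟨x, y, h⟩ := H.exists_isLink_of_mem_edgeSet he
  by_cases hxy : x = y
  · subst hxy
    have h1 : 0 < (N.filter fun z => H.Inc e z).card :=
      Finset.card_pos.2 ⟨x, Finset.mem_filter.2 ⟨hN x h.inc_left, h.inc_left⟩⟩
    have h2 : 0 < (N.filter fun z => H.IsLoopAt e z).card :=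
      Finset.card_pos.2 ⟨x, Finset.mem_filter.2 ⟨hN x h.inc_left, h⟩⟩
    omega
  · have h1 : ({x, y} : Finset α) ⊆ N.filter fun z => H.Inc e z := by
      intro z hz
      simp only [Finset.mem_insert, Finset.mem_singleton] at hz
      rcases hz with rfl | rfl
      · exact Finset.mem_filter.2 ⟨hN _ h.inc_left, h.inc_left⟩
      · exact Finset.mem_filter.2 ⟨hN _ h.inc_right, h.inc_right⟩
    have := Finset.card_le_card h1
    rw [Finset.card_pair hxy] at this
    omega

theorem excess_cycle {H : Graph α β} (hH : IsCycleGraph H) (hE : E(H).Finite) :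
    E(H).ncard ≤ V(H).ncard := by
  classical
  obtain ⟨hV, -, hd⟩ := hH
  have h := sum_deg hE hV.toFinset
  rw [Finset.sum_congr rfl (fun x hx => hd x (by simpa using hx))] at h
  have h2 : ∑ e ∈ hE.toFinset, 2 ≤ ∑ e ∈ hE.toFinset,
      ((hV.toFinset.filter fun x => H.Inc e x).card +
        (hV.toFinset.filter fun x => H.IsLoopAt e x).card) :=
    Finset.sum_le_sum fun e he => ends_count_eq _ (by simpa using he)
      fun x hx => by simpa using hx.vertex_mem
  rw [← h] at h2
  simp only [Finset.sum_const, smul_eq_mul] at h2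
  rw [Set.ncard_eq_toFinset_card _ hE, Set.ncard_eq_toFinset_card _ hV]
  omega

/-- Every edge set `X` with `Δ(G⟨X⟩) ≥ k` contains a member of `C_k(G)`. -/
theorem exists_mem_kCircuits {G : Graph α β} (hE : E(G).Finite) {k : ℕ} (hk : 1 ≤ k) {X : Set β}
    (hX : X ⊆ E(G)) (hd : (k : ℤ) ≤ excess (edgeInduce G X)) : ∃ C ∈ kCircuits G k, C ⊆ X := by
  have hfin : {Y : Set β | Y ⊆ X ∧ (k : ℤ) ≤ excess (edgeInduce G Y)}.Finite :=
    (hE.subset hX).finite_subsets.subset fun Y hY => hY.1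
  obtain ⟨C, hCmin⟩ := hfin.exists_minimal ⟨X, subset_rfl, hd⟩
  have hCX := hCmin.prop.1
  have hCd := hCmin.prop.2
  have hCE := hCX.trans hX
  have fC := hE.subset hCE
  have fV := vertexSet_edgeInduce_finite G fC
  have key : ∀ D : Set β, D ⊆ C → D ≠ C → excess (edgeInduce G D) < k := by
    intro D hD hne
    by_contra hcon
    exact hne (hD.antisymm (hCmin.2 ⟨hD.trans hCX, not_lt.1 hcon⟩ hD))
  refine ⟨C, ⟨hCE, ?_, ?_, ?_, ?_⟩, hCX⟩
  · rw [excess_edgeInduce hCE] at hCd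
    have hne : C.Nonempty := by
      by_contra h
      rw [Set.not_nonempty_iff_eq_empty] at h
      subst h
      simp at hCd
      omega
    obtain ⟨e, he⟩ := hne
    have h1 := key (C \ {e}) Set.sdiff_subset (fun h => by
      have : e ∈ C \ {e} := by rw [h]; exact he
      exact this.2 rfl)
    rw [excess_edgeInduce (Set.sdiff_subset.trans hCE)] at h1
    have h2 := Set.ncard_sdiff_singleton_add_one he fC
    have h3 := Set.ncard_le_ncard (vertexSet_edgeInduce_mono G (Set.sdiff_subset (s := C) (t := {e}))) fV
    rw [excess_edgeInduce hCE]
    omega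
  · rintro x ⟨e, he, hx⟩
    exact ⟨e, edgeInduce_inc.2 ⟨he, hx⟩⟩
  · intro x hxV hx
    have hsub : (edgeInduce G C).loopSet x ⊆ (edgeInduce G C).incidenceSet x :=
      fun _ h => ⟨x, h⟩
    have hincC : (edgeInduce G C).incidenceSet x ⊆ C := fun e he => (edgeInduce_inc.1 he).1
    have h0 := Set.ncard_le_ncard hsub (fC.subset hincC)
    have h1 : ((edgeInduce G C).incidenceSet x).ncard = 1 := by
      unfold deg at hx
      omega
    obtain ⟨e, he⟩ := Set.ncard_eq_one.1 h1
    have heC : e ∈ C := hincC (by rw [he]; rfl)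
    have h1 := key (C \ {e}) Set.sdiff_subset (fun h => by
      have : e ∈ C \ {e} := by rw [h]; exact heC
      exact this.2 rfl)
    rw [excess_edgeInduce (Set.sdiff_subset.trans hCE)] at h1
    rw [excess_edgeInduce hCE] at hCd
    have h2 := Set.ncard_sdiff_singleton_add_one heC fC
    have h3 : V(edgeInduce G (C \ {e})) ⊆ V(edgeInduce G C) \ {x} := by
      rintro y ⟨f, hf, hy⟩
      refine ⟨⟨f, hf.1, hy⟩, ?_⟩
      rintro rfl
      have : f ∈ (edgeInduce G C).incidenceSet y := edgeInduce_inc.2 ⟨hf.1, hy⟩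
      rw [he] at this
      exact hf.2 this
    have h4 := Set.ncard_le_ncard h3 (fV.subset Set.sdiff_subset)
    have h5 := Set.ncard_sdiff_singleton_add_one hxV fV
    omega
  · intro H hHc hcyc
    have hHE : E(H) ⊆ C := fun e he => (hHc.le.edgeSet_mono he).2
    have fH := fC.subset hHE
    have hVE := excess_cycle hcyc fH
    have hVC : V(H) ⊆ V(edgeInduce G C) := hHc.le.vertexSet_mono
    obtain ⟨-, hconn, -⟩ := hcyc
    obtain ⟨x, hx⟩ := hconn.nonempty
    have hne : ∃ e ∈ C, e ∈ E(H) := by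
      obtain ⟨e, he, hex⟩ := hVC hx
      exact ⟨e, he, hHc.closed (edgeInduce_inc.2 ⟨he, hex⟩) hx⟩
    obtain ⟨e, heC, heH⟩ := hne
    have h1 := key (C \ E(H)) Set.sdiff_subset (fun h => by
      have : e ∈ C \ E(H) := by rw [h]; exact heC
      exact this.2 heH)
    rw [excess_edgeInduce (Set.sdiff_subset.trans hCE)] at h1
    rw [excess_edgeInduce hCE] at hCd
    have h3 : V(edgeInduce G (C \ E(H))) ⊆ V(edgeInduce G C) \ V(H) := by
      rintro y ⟨f, hf, hy⟩
      exact ⟨⟨f, hf.1, hy⟩, fun hyH => hf.2 (hHc.closed (edgeInduce_inc.2 ⟨hf.1, hy⟩) hyH)⟩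
    have h4 := Set.ncard_le_ncard h3 (fV.subset Set.sdiff_subset)
    have h5 := Set.ncard_sdiff_add_ncard_of_subset hVC fV
    have h6 := Set.ncard_sdiff_add_ncard_of_subset hHE fC
    omega

/-- In a finite cacti-graph, proper edge subsets have smaller excess. -/
theorem excess_lt_of_ssubset {G : Graph α β} (hE : E(G).Finite) {C D : Set β} (hCE : C ⊆ E(G))
    (hC : IsCactiGraph (edgeInduce G C)) (hDC : D ⊂ C) :
    excess (edgeInduce G D) < excess (edgeInduce G C) := by
  classical
  have fC := hE.subset hCE
  have fV := vertexSet_edgeInduce_finite G fC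
  have fEC : E(edgeInduce G C).Finite := by rw [edgeSet_edgeInduce hCE]; exact fC
  rw [excess_edgeInduce hCE, excess_edgeInduce (hDC.1.trans hCE)]
  have hVV := vertexSet_edgeInduce_mono G hDC.1
  have h5 := Set.ncard_sdiff_add_ncard_of_subset hVV fV
  have h6 := Set.ncard_sdiff_add_ncard_of_subset hDC.1 fC
  suffices h : (V(edgeInduce G C) \ V(edgeInduce G D)).ncard < (C \ D).ncard by omega
  by_contra hcon
  rw [not_lt] at hcon
  have fN : (V(edgeInduce G C) \ V(edgeInduce G D)).Finite := fV.subset Set.sdiff_subset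
  have fZ : (C \ D).Finite := fC.subset Set.sdiff_subset
  rw [Set.ncard_eq_toFinset_card _ fN, Set.ncard_eq_toFinset_card _ fZ] at hcon
  set N := fN.toFinset with hN
  set Z := fZ.toFinset with hZ
  have memN : ∀ x, x ∈ N ↔ x ∈ V(edgeInduce G C) ∧ x ∉ V(edgeInduce G D) := fun x => by
    simp [hN]
  have memZ : ∀ e, e ∈ Z ↔ e ∈ C ∧ e ∉ D := fun e => by simp [hZ]
  have incZ : ∀ x ∈ N, ∀ e, (edgeInduce G C).Inc e x → e ∈ Z := by
    intro x hx e he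
    rw [memZ]
    refine ⟨(edgeInduce_inc.1 he).1, fun heD => ?_⟩
    exact ((memN x).1 hx).2 ⟨e, heD, (edgeInduce_inc.1 he).2⟩
  have hdeg : ∀ x ∈ N, 2 ≤ deg (edgeInduce G C) x := by
    intro x hx
    have hxV := ((memN x).1 hx).1
    obtain ⟨e, he⟩ := hC.1 x hxV
    have h1 : 0 < ((edgeInduce G C).incidenceSet x).ncard :=
      (Set.ncard_pos (fC.subset fun f hf => (edgeInduce_inc.1 hf).1)).2 ⟨e, he⟩
    have h2 := hC.2.1 x hxV
    unfold deg at *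
    omega
  have hsum := sum_deg fEC N
  have hZE : Z ⊆ fEC.toFinset := by
    intro e he
    rw [Set.Finite.mem_toFinset, edgeSet_edgeInduce hCE]
    exact ((memZ e).1 he).1
  rw [← Finset.sum_subset hZE (fun e _ heZ => by
    rw [Finset.filter_eq_empty_iff.2 (fun x hx hi => heZ (incZ x hx e hi)),
      Finset.filter_eq_empty_iff.2 (fun x hx hi => heZ (incZ x hx e hi.inc))]
    rfl)] at hsum
  have hw : ∀ e ∈ Z, ((N.filter fun x => (edgeInduce G C).Inc e x).card +
      (N.filter fun x => (edgeInduce G C).IsLoopAt e x).card) ≤ 2 := fun e he =>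
    ends_count_le N (by rw [edgeSet_edgeInduce hCE]; exact ((memZ e).1 he).1)
  have hs1 : ∑ x ∈ N, 2 ≤ ∑ x ∈ N, deg (edgeInduce G C) x := Finset.sum_le_sum hdeg
  have hs2 := Finset.sum_le_sum hw
  have hs3 : ∑ e ∈ Z, 2 ≤ ∑ x ∈ N, 2 := by
    simp only [Finset.sum_const, smul_eq_mul]
    omega
  have hdeg2 : ∀ x ∈ N, 2 = deg (edgeInduce G C) x :=
    (Finset.sum_eq_sum_iff_of_le hdeg).1 (by omega)
  have hw2 := (Finset.sum_eq_sum_iff_of_le hw).1 (by omega)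
  have hends : ∀ e ∈ Z, ∀ x, (edgeInduce G C).Inc e x → x ∈ N := by
    intro e he x hx
    by_contra hxN
    have := ends_count_lt N hx hxN
    have := hw2 e he
    omega
  obtain ⟨e₀, he₀C, he₀D⟩ := Set.exists_of_ssubset hDC
  obtain ⟨x₀, y₀, hxy₀⟩ := G.exists_isLink_of_mem_edgeSet (hCE he₀C)
  have hx₀ : x₀ ∈ N := hends e₀ ((memZ e₀).2 ⟨he₀C, he₀D⟩) x₀
    (edgeInduce_inc.2 ⟨he₀C, hxy₀.inc_left⟩)
  set R : Set α := {y | Relation.ReflTransGen (edgeInduce G C).Adj x₀ y} with hR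
  have hRN : ∀ y ∈ R, y ∈ N := by
    intro y hy
    induction hy with
    | refl => exact hx₀
    | tail _ hbc ih =>
      obtain ⟨e, he⟩ := hbc
      exact hends e (incZ _ ih e he.inc_left) _ he.inc_right
  have hRV : R ⊆ V(edgeInduce G C) := fun y hy => ((memN y).1 (hRN y hy)).1
  have hclosed : (edgeInduce G C).induce R ≤c edgeInduce G C := by
    refine Graph.IsClosedSubgraph.mk' (Graph.induce_le hRV) ?_
    rintro e x ⟨y, hxy⟩ hx
    have hxR : x ∈ R := hx
    have hyR : y ∈ R := Relation.ReflTransGen.tail hxR ⟨e, hxy⟩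
    exact Graph.IsLink.edge_mem (G := (edgeInduce G C).induce R) ⟨hxy, hxR, hyR⟩
  refine hC.2.2 _ hclosed ⟨fN.subset fun y hy => by simpa [hN] using hRN y hy, ?_, ?_⟩
  · have hreach : ∀ y (hy : y ∈ R), ((edgeInduce G C).induce R).toSimpleGraph.Reachable
        ⟨x₀, Relation.ReflTransGen.refl⟩ ⟨y, hy⟩ := by
      intro y hy
      induction hy with
      | refl => exact SimpleGraph.Reachable.refl _
      | @tail b c hb hbc ih =>
        refine ih.trans ?_
        by_cases hne : b = c
        · subst hne
          exact SimpleGraph.Reachable.refl _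
        · refine SimpleGraph.Adj.reachable ⟨fun h => hne (congrArg Subtype.val h), ?_⟩
          obtain ⟨e, he⟩ := hbc
          exact ⟨e, he, hb, Relation.ReflTransGen.tail hb ⟨e, he⟩⟩
    have : Nonempty V((edgeInduce G C).induce R) := ⟨⟨x₀, Relation.ReflTransGen.refl⟩⟩
    exact SimpleGraph.Connected.mk fun a b => (hreach a.1 a.2).symm.trans (hreach b.1 b.2)
  · intro x hx
    rw [hdeg2 x (hRN x hx)]
    have h1 : ((edgeInduce G C).induce R).incidenceSet x = (edgeInduce G C).incidenceSet x := by
      ext e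
      exact hclosed.inc_congr hx
    have h2 : ((edgeInduce G C).induce R).loopSet x = (edgeInduce G C).loopSet x := by
      ext e
      exact hclosed.isLink_congr hx
    rw [deg, deg, h1, h2]

/-- A set of edges is independent if it contains no member of `C_k(G)`. -/
def KIndep (G : Graph α β) (k : ℕ) (I : Set β) : Prop :=
  I ⊆ E(G) ∧ ∀ C ∈ kCircuits G k, ¬ C ⊆ I

theorem kIndep_iff {G : Graph α β} (hE : E(G).Finite) {k : ℕ} (hk : 1 ≤ k) {I : Set β} :
    KIndep G k I ↔ I ⊆ E(G) ∧ ∀ X ⊆ I, excess (edgeInduce G X) < k := by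
  refine and_congr_right fun hI => ⟨fun h X hX => ?_, fun h C hC hCI => ?_⟩
  · by_contra hcon
    obtain ⟨C, hC, hCX⟩ := exists_mem_kCircuits hE hk (hX.trans hI) (not_lt.1 hcon)
    exact h C hC (hCX.trans hX)
  · have := h C hCI
    rw [hC.2.1] at this
    exact lt_irrefl _ this

theorem kIndep_empty (G : Graph α β) {k : ℕ} (hk : 1 ≤ k) : KIndep G k ∅ := by
  refine ⟨Set.empty_subset _, fun C hC hC0 => ?_⟩
  obtain rfl := Set.subset_empty_iff.1 hC0
  have h := hC.2.1
  have hV : V(edgeInduce G ∅) = ∅ := by ext x; simp [mem_vertexSet_edgeInduce]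
  rw [excess_edgeInduce (Set.empty_subset _), hV] at h
  simp at h
  omega

theorem kIndep_aug {G : Graph α β} (hE : E(G).Finite) {k : ℕ} (hk : 1 ≤ k) {I J : Set β}
    (hI : KIndep G k I) (hJ : KIndep G k J) (hlt : I.ncard < J.ncard) :
    ∃ e ∈ J, e ∉ I ∧ KIndep G k (insert e I) := by
  rw [kIndep_iff hE hk] at hI hJ
  obtain ⟨hIE, hI⟩ := hI
  obtain ⟨hJE, hJ⟩ := hJ
  have fI := hE.subset hIE
  have fJ := hE.subset hJE
  by_contra! hcon
  have hT : ∀ e ∈ J, e ∉ I → ∃ T ⊆ I, (k : ℤ) - 1 ≤ excess (edgeInduce G T) ∧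
      ∀ x, G.Inc e x → x ∈ V(edgeInduce G T) := by
    intro e heJ heI
    have h := hcon e heJ heI
    rw [kIndep_iff hE hk] at h
    push Not at h
    obtain ⟨X, hXI, hX⟩ := h (Set.insert_subset (hJE heJ) hIE)
    have heX : e ∈ X := by
      by_contra heX
      have := hI X ((Set.subset_insert_iff_of_notMem heX).1 hXI)
      omega
    have hTI : X \ {e} ⊆ I := fun f hf => (hXI hf.1).resolve_left hf.2
    have hXE : X ⊆ E(G) := hXI.trans (Set.insert_subset (hJE heJ) hIE)
    have fX := hE.subset hXE
    have hTX : X \ {e} ⊆ X := Set.sdiff_subset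
    have h1 := hI _ hTI
    rw [excess_edgeInduce hXE] at hX
    have h2 := Set.ncard_sdiff_singleton_add_one heX fX
    have hmono := vertexSet_edgeInduce_mono G hTX
    have h3 := Set.ncard_le_ncard hmono (vertexSet_edgeInduce_finite G fX)
    rw [excess_edgeInduce (hTX.trans hXE)] at h1
    refine ⟨X \ {e}, hTI, ?_, fun x hx => ?_⟩
    · rw [excess_edgeInduce (hTX.trans hXE)]
      omega
    · have : V(edgeInduce G (X \ {e})) = V(edgeInduce G X) :=
        Set.eq_of_subset_of_ncard_le hmono (by omega) (vertexSet_edgeInduce_finite G fX)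
      rw [this]
      exact ⟨e, heX, hx⟩
  have hfin : {T : Set β | T ⊆ I ∧ (k : ℤ) - 1 ≤ excess (edgeInduce G T)}.Finite :=
    fI.finite_subsets.subset fun Y hY => hY.1
  have hJI : ∃ e ∈ J, e ∉ I := by
    by_contra! h
    exact absurd (Set.ncard_le_ncard h fI) (by omega)
  obtain ⟨e₁, he₁J, he₁I⟩ := hJI
  obtain ⟨T₁, hT₁I, hT₁, -⟩ := hT e₁ he₁J he₁I
  obtain ⟨T, hTmax⟩ := hfin.exists_maximal ⟨T₁, hT₁I, hT₁⟩
  have hTI := hTmax.prop.1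
  have hTd := hTmax.prop.2
  have hTE := hTI.trans hIE
  have fT := hE.subset hTE
  have hall : ∀ e ∈ J, e ∉ I → ∀ x, G.Inc e x → x ∈ V(edgeInduce G T) := by
    intro e heJ heI x hx
    obtain ⟨S, hSI, hSd, hSx⟩ := hT e heJ heI
    have hsup := excess_supermodular hE hTE (hSI.trans hIE)
    have hint := hI (T ∩ S) (Set.inter_subset_left.trans hTI)
    have hle := hTmax.2 (y := T ∪ S) ⟨Set.union_subset hTI hSI, by omega⟩ Set.subset_union_left
    exact vertexSet_edgeInduce_mono G (Set.subset_union_right.trans hle) (hSx x hx)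
  have hJ'J : J \ (I \ T) ⊆ J := Set.sdiff_subset
  have h1 := hJ _ hJ'J
  rw [excess_edgeInduce (hJ'J.trans hJE)] at h1
  have hsub : V(edgeInduce G (J \ (I \ T))) ⊆ V(edgeInduce G T) := by
    rintro x ⟨e, he, hx⟩
    by_cases heI : e ∈ I
    · have heT : e ∈ T := by
        by_contra heT
        exact he.2 ⟨heI, heT⟩
      exact ⟨e, heT, hx⟩
    · exact hall e he.1 heI x hx
  have h2 := Set.ncard_le_ncard hsub (vertexSet_edgeInduce_finite G fT)
  rw [excess_edgeInduce hTE] at hTd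
  have h3 := Set.ncard_sdiff_add_ncard_of_subset hTI fI
  have h4 : J.ncard ≤ (J \ (I \ T)).ncard + (I \ T).ncard := by
    have h := Set.ncard_le_ncard_sdiff_add_ncard J (I \ T) (fI.subset Set.sdiff_subset)
    exact h
  omega

/-- The `k`-circular matroid `M_k(G)` of a graph `G` with finitely many edges, where `k ≥ 1`: its
ground set is `E(G)` and its circuits are the members of `C_k(G)`
(see `kCircularMatroid_isCircuit_iff`). -/
noncomputable def kCircularMatroid (G : Graph α β) (hE : E(G).Finite) (k : ℕ) (hk : 1 ≤ k) :
    Matroid β :=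
  (IndepMatroid.ofFinite hE (KIndep G k) (kIndep_empty G hk)
    (fun _ _ hJ hIJ => ⟨hIJ.trans hJ.1, fun C hC hCI => hJ.2 C hC (hCI.trans hIJ)⟩)
    (fun _ _ hI hJ hlt => kIndep_aug hE hk hI hJ hlt) (fun _ hI => hI.1)).matroid

theorem kCircularMatroid_ground (G : Graph α β) (hE : E(G).Finite) (k : ℕ) (hk : 1 ≤ k) :
    (kCircularMatroid G hE k hk).E = E(G) := rfl

theorem kCircularMatroid_indep_iff (G : Graph α β) (hE : E(G).Finite) (k : ℕ) (hk : 1 ≤ k)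
    {I : Set β} : (kCircularMatroid G hE k hk).Indep I ↔ KIndep G k I := Iff.rfl

theorem kCircularMatroid_isCircuit_iff (G : Graph α β) (hE : E(G).Finite) (k : ℕ) (hk : 1 ≤ k)
    {C : Set β} : (kCircularMatroid G hE k hk).IsCircuit C ↔ C ∈ kCircuits G k := by
  have hdep : ∀ C ∈ kCircuits G k, (kCircularMatroid G hE k hk).Dep C := fun C hC =>
    ⟨fun h => h.2 C hC subset_rfl, hC.1⟩
  constructor
  · intro h
    have h1 : ¬ KIndep G k C := h.dep.not_indep
    have hCE : C ⊆ E(G) := h.subset_ground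
    rw [KIndep] at h1
    push Not at h1
    obtain ⟨D, hD, hDC⟩ := h1 hCE
    rwa [← h.eq_of_dep_subset (hdep D hD) hDC]
  · intro hC
    refine ⟨hdep C hC, fun D hD hDC => ?_⟩
    by_contra hne
    have h1 : ¬ KIndep G k D := hD.not_indep
    rw [KIndep] at h1
    push Not at h1
    obtain ⟨F, hF, hFD⟩ := h1 (hDC.trans hC.1)
    have h2 := excess_lt_of_ssubset hE hC.1 hC.2.2
      ⟨hFD.trans hDC, fun h => hne (h.trans hFD)⟩
    rw [hC.2.1, hF.2.1] at h2
    exact lt_irrefl _ h2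

/-- The corank of `M_k(G)`, i.e. the rank of its dual matroid. -/
noncomputable def corank (G : Graph α β) (hE : E(G).Finite) (k : ℕ) (hk : 1 ≤ k) : ℕ∞ :=
  (kCircularMatroid G hE k hk)✶.eRank

/-- The vertex `x` is `k`-small: its star (the set of edges incident to `x`) has fewer than
`corank + 1` elements. -/
def IsKSmall (G : Graph α β) (hE : E(G).Finite) (k : ℕ) (hk : 1 ≤ k) (x : α) : Prop :=
  (G.incidenceSet x).encard < corank G hE k hk + 1

/-- The vertex `x` is `k`-tight: its star has exactly `corank + 1` elements. -/
def IsKTight (G : Graph α β) (hE : E(G).Finite) (k : ℕ) (hk : 1 ≤ k) (x : α) : Prop :=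
  (G.incidenceSet x).encard = corank G hE k hk + 1

/-- Two graphs with the same edges are strongly isomorphic if some bijection between their vertex
sets respects the ends of every edge. -/
def StronglyIsomorphic {α' : Type u} (G : Graph α β) (G' : Graph α' β) : Prop :=
  E(G) = E(G') ∧ ∃ ν : V(G) ≃ V(G'), ∀ (e : β) (x y : V(G)),
    G.IsLink e x y ↔ G'.IsLink e (ν x) (ν y)

/-- `G` is uniquely defined by `M_k(G)`: every finite graph without isolated vertices (loops and
parallel edges being allowed) that has the same `k`-circular matroid is strongly isomorphic to
`G`. (Isolated vertices are invisible in `M_k`.) -/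
def UniquelyDefined (G : Graph α β) (hE : E(G).Finite) (k : ℕ) (hk : 1 ≤ k) : Prop :=
  ∀ (α' : Type u) (G' : Graph α' β), V(G').Finite → ∀ hE' : E(G').Finite, NoIsolatedVertex G' →
    kCircularMatroid G' hE' k hk = kCircularMatroid G hE k hk → StronglyIsomorphic G G'

/-- `3`-connected: at least four vertices, no loops, and deleting fewer than three
vertices leaves a connected graph. Parallel edges are not excluded. -/
def IsThreeConnected (G : Graph α β) : Prop :=
  G.Loopless ∧ 4 ≤ V(G).encard ∧
    ∀ X ⊆ V(G), X.encard < 3 → IsConnected (G.deleteVerts X)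

end KCircular

/-! Write Δ(X) for Δ(G⟨X⟩). A set of edges is independent iff all its subsets have Δ < k, and the
matroid counts vertices: a nonempty union X of circuits has rank |V(G⟨X⟩)| + k - 1
(`ncard_basis_of_cyclic`). If G is 3-connected with Δ(G) ≥ k, then E(G) is such a union, so the
corank is |E(G)| - |V(G)| - k + 1. Hence x is small, tight or neither according as Δ(G - x) is at
least k, equal to k - 1, or at most k - 2.

Sufficiency. Let M_k(G') = M_k(G); then |V(G')| = |V(G)|. If x is small, E(G - x) is again a union
of circuits, so in G' it misses some vertex x', and the star of x' lies in that of x. An edge at x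
but not at x', added to a basis of E(G - x), would give an independent set too large to miss x' in
G'. So small stars are stars of G' (`exists_star_of_small`). If only a tight vertex t remains,
counting vertices leaves one candidate t', and a similar argument applies because E(G - t) is itself
independent (`exists_star_of_tight`). The stars determine the graph.

Necessity. If Δ(G - x) ≤ k - 2, turning an edge xy into a loop at y does not change the matroid
(`not_uniquelyDefined_of_big`). If Δ(G - x) ≤ k - 1 for two vertices x₁ and x₂, every dependent set
covers both, so edges x₁y₁ and x₂y₂ may be exchanged for x₂y₁ and x₁y₂
(`not_uniquelyDefined_of_pair`). Neither new graph is strongly isomorphic to G. What survives these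
two modifications is exactly (c2). -/

namespace KCircular

/-! ### Excess and circuits in connected graphs -/

section Connectivity

variable {α : Type u} {β : Type v} {G : Graph α β} {k : ℕ}

theorem vertexSet_edgeInduce_insert (G : Graph α β) (e : β) (X : Set β) :
    V(edgeInduce G (insert e X)) = {x | G.Inc e x} ∪ V(edgeInduce G X) := by
  ext x
  simp [mem_vertexSet_edgeInduce]

/-- Deleting the only edge at some vertex does not decrease the excess. -/
theorem excess_le_excess_sdiff (hE : E(G).Finite) {X : Set β} (hX : X ⊆ E(G)) {e : β} {x : α}
    (he : e ∈ X) (hx : G.Inc e x) (hxX : x ∉ V(edgeInduce G (X \ {e}))) :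
    excess (edgeInduce G X) ≤ excess (edgeInduce G (X \ {e})) := by
  have fX := hE.subset hX
  have fV := vertexSet_edgeInduce_finite G fX
  rw [excess_edgeInduce hX, excess_edgeInduce (Set.sdiff_subset.trans hX)]
  have h1 := Set.ncard_sdiff_singleton_add_one he fX
  have hxV : x ∈ V(edgeInduce G X) := ⟨e, he, hx⟩
  have h2 := Set.ncard_sdiff_singleton_add_one hxV fV
  have h3 : V(edgeInduce G (X \ {e})) ⊆ V(edgeInduce G X) \ {x} := fun y hy =>
    ⟨vertexSet_edgeInduce_mono G Set.sdiff_subset hy, fun h => hxX (h ▸ hy)⟩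
  have h4 := Set.ncard_le_ncard h3 (fV.subset Set.sdiff_subset)
  omega

/-- Adding an edge with a new end preserves independence. -/
theorem KIndep.insert_of_new_end (hE : E(G).Finite) (hk : 1 ≤ k) {I : Set β} (hI : KIndep G k I)
    {e : β} {x : α} (hx : G.Inc e x) (hxI : x ∉ V(edgeInduce G I)) :
    KIndep G k (insert e I) := by
  rw [kIndep_iff hE hk] at hI ⊢
  refine ⟨Set.insert_subset hx.edge_mem hI.1, fun X hX => ?_⟩
  have hXI : X \ {e} ⊆ I := fun f hf => (hX hf.1).resolve_left hf.2
  by_cases he : e ∈ X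
  · refine (excess_le_excess_sdiff hE (hX.trans (Set.insert_subset hx.edge_mem hI.1)) he hx
      fun h => hxI ?_).trans_lt (hI.2 _ hXI)
    exact vertexSet_edgeInduce_mono G hXI h
  · exact hI.2 X fun f hf => (hX hf).resolve_left fun h => he (h ▸ hf)

/-- The edges in `X` have all their ends in `U` and leave every nonempty proper subset of `U`,
that is, the graph with vertex set `U` and edge set `X` is connected. -/
structure ConnectsOn (G : Graph α β) (U : Set α) (X : Set β) : Prop where
  subset_edgeSet : X ⊆ E(G)
  ends_mem : ∀ e ∈ X, ∀ x, G.Inc e x → x ∈ U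
  exists_isLink : ∀ W ⊆ U, W.Nonempty → W ≠ U → ∃ e ∈ X, ∃ a ∈ W, ∃ b ∈ U \ W, G.IsLink e a b

theorem ConnectsOn.vertexSet_subset {U : Set α} {X Y : Set β} (h : ConnectsOn G U X)
    (hY : Y ⊆ X) : V(edgeInduce G Y) ⊆ U := by
  rintro x ⟨e, he, hx⟩
  exact h.ends_mem e (hY he) x hx

theorem ConnectsOn.insert_edge {U : Set α} {X : Set β} (h : ConnectsOn G U X) {e : β} (he : e ∈ E(G))
    (hU : ∀ x, G.Inc e x → x ∈ U) : ConnectsOn G U (insert e X) where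
  subset_edgeSet := Set.insert_subset he h.subset_edgeSet
  ends_mem := by
    rintro f (rfl | hf)
    exacts [hU, h.ends_mem f hf]
  exists_isLink W hW h1 h2 := by
    obtain ⟨f, hf, h⟩ := h.exists_isLink W hW h1 h2
    exact ⟨f, Or.inr hf, h⟩

/-- In a connected graph every nonempty set of edges extends to a spanning one of the same excess,
preserving independence. -/
theorem ConnectsOn.exists_spanning_extension (hE : E(G).Finite) (hk : 1 ≤ k) {U : Set α}
    {X Y : Set β} (h : ConnectsOn G U X) (hYX : Y ⊆ X) (hY : Y.Nonempty) :
    ∃ Z, Y ⊆ Z ∧ Z ⊆ X ∧ V(edgeInduce G Z) = U ∧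
      excess (edgeInduce G Z) = excess (edgeInduce G Y) ∧ (KIndep G k Y → KIndep G k Z) := by
  have fX := hE.subset h.subset_edgeSet
  have hfin : {Z : Set β | Y ⊆ Z ∧ Z ⊆ X ∧ excess (edgeInduce G Z) = excess (edgeInduce G Y) ∧
      (KIndep G k Y → KIndep G k Z)}.Finite :=
    fX.finite_subsets.subset fun Z hZ => hZ.2.1
  obtain ⟨Z, hZ⟩ := hfin.exists_maximal ⟨Y, subset_rfl, hYX, rfl, id⟩
  obtain ⟨hYZ, hZX, hZe, hZI⟩ := hZ.prop
  refine ⟨Z, hYZ, hZX, ?_, hZe, hZI⟩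
  by_contra hne
  have hsub := h.vertexSet_subset hZX
  have hWne : V(edgeInduce G Z).Nonempty := by
    obtain ⟨e, he⟩ := hY
    obtain ⟨a, b, hab⟩ := G.exists_isLink_of_mem_edgeSet (h.subset_edgeSet (hYX he))
    exact ⟨a, e, hYZ he, hab.inc_left⟩
  -- An edge leaving the vertex set of G⟨`Z`⟩ brings exactly one new vertex, so it keeps the excess,
  -- and its new end keeps independence: this contradicts maximality.
  obtain ⟨e, heX, a, ha, b, hb, hab⟩ := h.exists_isLink _ hsub hWne hne
  have heZ : e ∉ Z := fun he => hb.2 ⟨e, he, hab.inc_right⟩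
  have hins : insert e Z ⊆ X := Set.insert_subset heX hZX
  have hends : V(edgeInduce G (insert e Z)) = insert b V(edgeInduce G Z) := by
    rw [vertexSet_edgeInduce_insert]
    ext x
    constructor
    · rintro (hx | hx)
      · rcases Graph.Inc.eq_or_eq_of_isLink hx hab with rfl | rfl
        exacts [Or.inr ha, Or.inl rfl]
      · exact Or.inr hx
    · rintro (rfl | hx)
      exacts [Or.inl hab.inc_right, Or.inr hx]
  have hex : excess (edgeInduce G (insert e Z)) = excess (edgeInduce G Y) := by
    rw [← hZe, excess_edgeInduce (hins.trans h.subset_edgeSet),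
      excess_edgeInduce (hZX.trans h.subset_edgeSet), hends,
      Set.ncard_insert_of_notMem heZ (fX.subset hZX),
      Set.ncard_insert_of_notMem hb.2 (vertexSet_edgeInduce_finite G (fX.subset hZX))]
    push_cast
    ring
  exact heZ (hZ.2 ⟨hYZ.trans (Set.subset_insert _ _), hins, hex,
    fun hY => (hZI hY).insert_of_new_end hE hk hab.inc_right hb.2⟩ (Set.subset_insert _ _)
    (Set.mem_insert _ _))

/-- In a connected graph the excess of a nonempty set of edges is at most that of the graph. -/
theorem ConnectsOn.excess_le (hE : E(G).Finite) {U : Set α} {X Y : Set β}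
    (h : ConnectsOn G U X) (hYX : Y ⊆ X) (hY : Y.Nonempty) :
    excess (edgeInduce G Y) ≤ (X.ncard : ℤ) - (U.ncard : ℤ) := by
  -- The parameter k enters only the discarded independence clause; `le_rfl` sets it to 1.
  obtain ⟨Z, -, hZX, hZU, hZe, -⟩ := h.exists_spanning_extension hE le_rfl hYX hY
  rw [← hZe, excess_edgeInduce (hZX.trans h.subset_edgeSet), hZU]
  have := Set.ncard_le_ncard hZX (hE.subset h.subset_edgeSet)
  omega

theorem excess_edgeInduce_empty (G : Graph α β) : excess (edgeInduce G ∅) = 0 := by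
  have hV : V(edgeInduce G ∅) = ∅ := by ext x; simp [mem_vertexSet_edgeInduce]
  rw [excess_edgeInduce (Set.empty_subset _), hV]
  simp

/-- A connected graph of excess less than `k` is independent. -/
theorem ConnectsOn.excess_lt (hE : E(G).Finite) (hk : 1 ≤ k) {U : Set α} {X Y : Set β}
    (h : ConnectsOn G U X) (hX : X.ncard < U.ncard + k) (hYX : Y ⊆ X) :
    excess (edgeInduce G Y) < k := by
  rcases Y.eq_empty_or_nonempty with rfl | hY
  · rw [excess_edgeInduce_empty]
    omega
  · have := h.excess_le hE hYX hY
    omega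

theorem ConnectsOn.kIndep (hE : E(G).Finite) (hk : 1 ≤ k) {U : Set α} {X : Set β}
    (h : ConnectsOn G U X) (hX : X.ncard < U.ncard + k) : KIndep G k X :=
  (kIndep_iff hE hk).2 ⟨h.subset_edgeSet, fun _ hY => h.excess_lt hE hk hX hY⟩

/-- An edge added to a connected graph of excess at least `k - 1` completes a circuit. -/
theorem ConnectsOn.exists_circuit (hE : E(G).Finite) (hk : 1 ≤ k) {U : Set α} (hU : U.Finite)
    {X : Set β} (h : ConnectsOn G U X) (hX : U.ncard + k ≤ X.ncard + 1) {e : β} (he : e ∈ E(G))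
    (heX : e ∉ X) (heU : ∀ x, G.Inc e x → x ∈ U) :
    ∃ C ∈ kCircuits G k, e ∈ C ∧ C ⊆ insert e X := by
  have h' := h.insert_edge he heU
  have hXE := h'.subset_edgeSet
  have fX := hE.subset h.subset_edgeSet
  have hd : (k : ℤ) ≤ excess (edgeInduce G (insert e X)) := by
    rw [excess_edgeInduce hXE, Set.ncard_insert_of_notMem heX fX]
    have := Set.ncard_le_ncard (h'.vertexSet_subset subset_rfl) hU
    push_cast
    omega
  obtain ⟨C, hC, hCX⟩ := exists_mem_kCircuits hE hk hXE hd
  by_cases heC : e ∈ C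
  · exact ⟨C, hC, heC, hCX⟩
  have hCX' : C ⊆ X := fun f hf => (hCX hf).resolve_left fun h => heC (h ▸ hf)
  have fC := fX.subset hCX'
  have hCe := hC.2.1
  rw [excess_edgeInduce hC.1] at hCe
  obtain ⟨f, hf⟩ : C.Nonempty := by
    by_contra hcon
    rw [Set.not_nonempty_iff_eq_empty.1 hcon, Set.ncard_empty] at hCe
    omega
  have h1 := Set.ncard_sdiff_singleton_add_one hf fC
  have hV0 := Set.ncard_le_ncard (vertexSet_edgeInduce_mono G
    (Set.sdiff_subset : C \ {f} ⊆ C)) (vertexSet_edgeInduce_finite G fC)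
  -- |C| = |V(G⟨C⟩)| + k ≥ 2, as there is at least one vertex and k ≥ 1.
  have hCf : (C \ {f}).Nonempty := by
    rw [← Set.ncard_pos (fC.subset Set.sdiff_subset)]
    have hpos : 0 < V(edgeInduce G C).ncard := by
      rw [Set.ncard_pos (vertexSet_edgeInduce_finite G fC)]
      obtain ⟨a, b, hab⟩ := G.exists_isLink_of_mem_edgeSet (hC.1 hf)
      exact ⟨a, f, hf, hab.inc_left⟩
    omega
  have hCfE : C \ {f} ⊆ E(G) := Set.sdiff_subset.trans hC.1
  have hI : KIndep G k (C \ {f}) := by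
    refine (kIndep_iff hE hk).2 ⟨hCfE, fun Y hY => ?_⟩
    rw [← hC.2.1]
    exact excess_lt_of_ssubset hE hC.1 hC.2.2
      ⟨hY.trans Set.sdiff_subset, fun hCY => (hY (hCY hf)).2 rfl⟩
  -- The found circuit misses `e`, but without `f` it is independent of excess k - 1. Extended to an
  -- independent `Z` spanning `U`, it becomes dependent when `e` is added, since `e` brings no
  -- vertex; a circuit in `insert e Z` must then use `e`.
  obtain ⟨Z, -, hZX, hZU, hZe, hZI⟩ := h.exists_spanning_extension hE hk
    (Set.sdiff_subset.trans hCX') hCf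
  have heZ : e ∉ Z := fun h => heX (hZX h)
  have hZE := hZX.trans h.subset_edgeSet
  have hZ' : (k : ℤ) ≤ excess (edgeInduce G (insert e Z)) := by
    rw [excess_edgeInduce hZE, excess_edgeInduce hCfE] at hZe
    rw [excess_edgeInduce (Set.insert_subset he hZE), vertexSet_edgeInduce_insert,
      Set.ncard_insert_of_notMem heZ (fX.subset hZX), hZU,
      Set.union_eq_right.2 (show {x | G.Inc e x} ⊆ U from heU)]
    rw [hZU] at hZe
    push_cast
    omega
  obtain ⟨D, hD, hDZ⟩ := exists_mem_kCircuits hE hk (Set.insert_subset he hZE) hZ'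
  refine ⟨D, hD, ?_, hDZ.trans (Set.insert_subset_insert hZX)⟩
  by_contra heD
  exact (hZI hI).2 D hD fun g hg => (hDZ hg).resolve_left fun h => heD (h ▸ hg)

end Connectivity

/-! ### Rank of unions of circuits -/

section Cyclic

variable {α : Type u} {β : Type v} {G : Graph α β} {k : ℕ}

/-- The number of vertices of a nonempty union of circuits is determined by its rank. -/
theorem ncard_basis_of_cyclic (hE : E(G).Finite) (hk : 1 ≤ k) {X B : Set β} (hXne : X.Nonempty)
    (hX : ∀ e ∈ X, ∃ C ∈ kCircuits G k, e ∈ C ∧ C ⊆ X)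
    (hB : (kCircularMatroid G hE k hk).IsBasis B X) :
    B.ncard + 1 = V(edgeInduce G X).ncard + k := by
  have hXE : X ⊆ E(G) := hB.subset_ground
  have hBX := hB.subset
  have hBE := hBX.trans hXE
  have fB := hE.subset hBE
  have hBI : KIndep G k B := hB.indep
  have hBd := ((kIndep_iff hE hk).1 hBI).2
  -- `T` is the fundamental circuit of `f` without `f`. Its excess must drop below k by the loss of
  -- a single edge, so no vertex is lost and the ends of `f` stay covered.
  have hT : ∀ f ∈ X, f ∉ B → ∃ T ⊆ B, (k : ℤ) - 1 ≤ excess (edgeInduce G T) ∧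
      ∀ x, G.Inc f x → x ∈ V(edgeInduce G T) := by
    intro f hfX hfB
    have h : ¬ KIndep G k (insert f B) := fun h => hfB (hB.mem_of_insert_indep hfX h)
    rw [KIndep] at h
    push Not at h
    obtain ⟨C, hC, hCB⟩ := h (Set.insert_subset (hXE hfX) hBE)
    have hfC : f ∈ C := by
      by_contra hfC
      exact hBI.2 C hC fun g hg => (hCB hg).resolve_left fun h => hfC (h ▸ hg)
    have hTB : C \ {f} ⊆ B := fun g hg => (hCB hg.1).resolve_left hg.2
    have fC := hE.subset hC.1
    have hCe := hC.2.1
    have hTe := hBd _ hTB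
    rw [excess_edgeInduce hC.1] at hCe
    rw [excess_edgeInduce (hTB.trans hBE)] at hTe
    have h1 := Set.ncard_sdiff_singleton_add_one hfC fC
    have hmono := vertexSet_edgeInduce_mono G (Set.sdiff_subset : C \ {f} ⊆ C)
    have h2 := Set.ncard_le_ncard hmono (vertexSet_edgeInduce_finite G fC)
    refine ⟨_, hTB, ?_, fun x hx => ?_⟩
    · rw [excess_edgeInduce (hTB.trans hBE)]
      omega
    · rw [Set.eq_of_subset_of_ncard_le hmono (by omega) (vertexSet_edgeInduce_finite G fC)]
      exact ⟨f, hfC, hx⟩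
  have hfin : {T : Set β | T ⊆ B ∧ (k : ℤ) - 1 ≤ excess (edgeInduce G T)}.Finite :=
    fB.finite_subsets.subset fun Y hY => hY.1
  obtain ⟨f₀, hf₀X, hf₀B⟩ : ∃ f ∈ X, f ∉ B := by
    by_contra! h
    obtain ⟨e, he⟩ := hXne
    obtain ⟨C, hC, -, hCX⟩ := hX e he
    exact hBI.2 C hC (hCX.trans h)
  obtain ⟨T₀, hT₀B, hT₀, -⟩ := hT f₀ hf₀X hf₀B
  obtain ⟨T, hTmax⟩ := hfin.exists_maximal ⟨T₀, hT₀B, hT₀⟩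
  obtain ⟨hTB, hTd⟩ := hTmax.prop
  have hTE := hTB.trans hBE
  have fT := fB.subset hTB
  have hends : ∀ f ∈ X, f ∉ B → ∀ x, G.Inc f x → x ∈ V(edgeInduce G T) := by
    intro f hfX hfB x hx
    obtain ⟨S, hSB, hSd, hSx⟩ := hT f hfX hfB
    -- Subsets of `B` have excess at most k - 1, so by supermodularity those attaining k - 1 are
    -- closed under union. The maximal `T` therefore contains every `S`.
    have hsup := excess_supermodular hE hTE (hSB.trans hBE)
    have hint := hBd (T ∩ S) (Set.inter_subset_left.trans hTB)
    have hle := hTmax.2 (y := T ∪ S) ⟨Set.union_subset hTB hSB, by omega⟩ Set.subset_union_left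
    exact vertexSet_edgeInduce_mono G (Set.subset_union_right.trans hle) (hSx x hx)
  -- Otherwise a circuit `C` in `X` meets `B \ T` in a nonempty set `C₁`. The other edges of `C`
  -- have their ends in V(G⟨T⟩), and removing `C₁` lowers the excess of `C`; so `C₁` has more edges
  -- than `C` has vertices outside V(G⟨T⟩). Then `T ∪ C₁`, a subset of `B`, has excess at least k.
  have hTeq : B ⊆ T := by
    intro f hfB
    by_contra hfT
    obtain ⟨C, hC, hfC, hCX⟩ := hX f (hBX hfB)
    have fC := hE.subset hC.1
    have fVC := vertexSet_edgeInduce_finite G fC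
    have fVT := vertexSet_edgeInduce_finite G fT
    set C₁ := C ∩ (B \ T) with hC₁
    have hC₁C : C₁ ⊆ C := Set.inter_subset_left
    have hC₀ := excess_lt_of_ssubset hE hC.1 hC.2.2 (D := C \ C₁)
      ⟨Set.sdiff_subset, fun h => (h hfC).2 ⟨hfC, hfB, hfT⟩⟩
    rw [hC.2.1, excess_edgeInduce (Set.sdiff_subset.trans hC.1)] at hC₀
    have hCe := hC.2.1
    rw [excess_edgeInduce hC.1] at hCe
    have h1 := Set.ncard_sdiff_add_ncard_of_subset hC₁C fC
    have hV₀ : V(edgeInduce G (C \ C₁)) ⊆ V(edgeInduce G C) ∩ V(edgeInduce G T) := by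
      rintro x ⟨g, hg, hx⟩
      refine ⟨⟨g, hg.1, hx⟩, ?_⟩
      by_cases hgB : g ∈ B
      · refine ⟨g, ?_, hx⟩
        by_contra hgT
        exact hg.2 ⟨hg.1, hgB, hgT⟩
      · exact hends g (hCX hg.1) hgB x hx
    have h2 := Set.ncard_le_ncard hV₀ (fVC.subset Set.inter_subset_left)
    have h3 := Set.ncard_union_add_ncard_inter _ _ fVC fVT
    have hdisj : Disjoint T C₁ := Set.disjoint_left.2 fun g hg hg' => hg'.2.2 hg
    have h4 := Set.ncard_union_eq hdisj fT (fC.subset hC₁C)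
    have hsub : T ∪ C₁ ⊆ B := Set.union_subset hTB fun g hg => hg.2.1
    have h5 := hBd _ hsub
    rw [excess_edgeInduce (hsub.trans hBE), h4, vertexSet_edgeInduce_union] at h5
    have h6 : V(edgeInduce G T) ∪ V(edgeInduce G C₁) ⊆
        V(edgeInduce G C) ∪ V(edgeInduce G T) :=
      Set.union_subset Set.subset_union_right
        ((vertexSet_edgeInduce_mono G hC₁C).trans Set.subset_union_left)
    have h7 := Set.ncard_le_ncard h6 (fVC.union fVT)
    rw [excess_edgeInduce hTE] at hTd
    push_cast at h5
    omega
  obtain rfl : T = B := hTB.antisymm hTeq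
  have hVX : V(edgeInduce G X) = V(edgeInduce G T) := by
    refine Set.Subset.antisymm ?_ (vertexSet_edgeInduce_mono G hBX)
    rintro x ⟨f, hf, hx⟩
    by_cases hfB : f ∈ T
    · exact ⟨f, hfB, hx⟩
    · exact hends f hf hfB x hx
  have h1 := hBd T subset_rfl
  rw [excess_edgeInduce hTE] at h1 hTd
  rw [hVX]
  omega

/-- The number of vertices of a union of circuits is determined by the matroid. -/
theorem ncard_vertexSet_eq_of_cyclic {α' : Type u} {G' : Graph α' β} (hE : E(G).Finite)
    (hE' : E(G').Finite) (hk : 1 ≤ k)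
    (hM : kCircularMatroid G' hE' k hk = kCircularMatroid G hE k hk) {X : Set β}
    (hXne : X.Nonempty) (hX : ∀ e ∈ X, ∃ C ∈ kCircuits G k, e ∈ C ∧ C ⊆ X) :
    V(edgeInduce G' X).ncard = V(edgeInduce G X).ncard := by
  have hcirc : ∀ C, C ∈ kCircuits G' k ↔ C ∈ kCircuits G k := fun C => by
    rw [← kCircularMatroid_isCircuit_iff G' hE' k hk, hM, kCircularMatroid_isCircuit_iff]
  have hXE : X ⊆ (kCircularMatroid G hE k hk).E := fun e he => by
    obtain ⟨C, hC, heC, -⟩ := hX e he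
    exact hC.1 heC
  obtain ⟨B, hB⟩ := (kCircularMatroid G hE k hk).exists_isBasis X hXE
  have h1 := ncard_basis_of_cyclic hE hk hXne hX hB
  have h2 := ncard_basis_of_cyclic (G := G') hE' hk hXne
    (fun e he => by
      obtain ⟨C, hC, h⟩ := hX e he
      exact ⟨C, (hcirc C).2 hC, h⟩) (hM ▸ hB)
  omega

end Cyclic

end KCircular

namespace KCircular

/-! ### Consequences of 3-connectedness; small and tight vertices as counts of edges -/

section ThreeConnected

variable {α : Type u} {β : Type v} {G : Graph α β} {k : ℕ}

/-- A walk from `W` to its complement in G - D must cross the boundary. Connectivity is used below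
only in this cut form. -/
theorem IsThreeConnected.exists_isLink_of_cut (hG : IsThreeConnected G) {D W : Set α}
    (hD : D ⊆ V(G)) (hD3 : D.encard < 3) (hW : W ⊆ V(G) \ D) (hWne : W.Nonempty)
    (hne : W ≠ V(G) \ D) : ∃ e, ∃ a ∈ W, ∃ b ∈ (V(G) \ D) \ W, G.IsLink e a b := by
  have hc : (G.deleteVerts D).toSimpleGraph.Connected := hG.2.2 D hD hD3
  obtain ⟨a, ha⟩ := hWne
  obtain ⟨b, hb, hbW⟩ : ∃ b ∈ V(G) \ D, b ∉ W := by
    by_contra! h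
    exact hne (hW.antisymm h)
  have hV := vertexSet_deleteVerts G D
  obtain ⟨p⟩ := hc.preconnected ⟨a, hV ▸ hW ha⟩ ⟨b, hV ▸ hb⟩
  obtain ⟨d, -, h1, h2⟩ := p.exists_boundary_dart {x | x.1 ∈ W} ha hbW
  obtain ⟨-, e, he⟩ := d.adj
  exact ⟨e, d.fst, h1, d.snd, ⟨hV ▸ d.snd.2, h2⟩, ((deleteVerts_isLink G D).1 he).1⟩

theorem IsThreeConnected.not_vertexSet_subset (hG : IsThreeConnected G) {S : Set α}
    (hS : S.encard ≤ 3) : ∃ y ∈ V(G), y ∉ S := by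
  by_contra! h
  have h1 := hG.2.1.trans ((Set.encard_le_encard h).trans hS)
  norm_num at h1

/-- A vertex has a neighbour outside any set of at most two other vertices. -/
theorem IsThreeConnected.exists_isLink_notMem (hG : IsThreeConnected G) {x : α} (hx : x ∈ V(G))
    {D : Set α} (hD : D ⊆ V(G)) (hD2 : D.encard ≤ 2) (hxD : x ∉ D) :
    ∃ e y, G.IsLink e x y ∧ y ∉ D ∧ y ≠ x := by
  obtain ⟨z, hz, hzS⟩ := hG.not_vertexSet_subset (S := insert x D)
    ((Set.encard_insert_le _ _).trans (by
      calc D.encard + 1 ≤ 2 + 1 := by gcongr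
        _ = 3 := by norm_num))
  have hz' : z ≠ x ∧ z ∉ D := by simpa using hzS
  obtain ⟨e, a, rfl, b, hb, hab⟩ := hG.exists_isLink_of_cut hD (hD2.trans_lt (by norm_num))
    (W := {x}) (Set.singleton_subset_iff.2 ⟨hx, hxD⟩) (Set.singleton_nonempty x)
    (fun h => hz'.1 (by
      have : z ∈ ({x} : Set α) := h ▸ ⟨hz, hz'.2⟩
      exact this))
  exact ⟨e, b, hab, hb.1.2, hb.2⟩

/-- Deleting at most one vertex and one edge leaves a connected graph. -/
theorem IsThreeConnected.connectsOn_sdiff (hG : IsThreeConnected G) {D : Set α} (hD : D ⊆ V(G))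
    (hD1 : D.encard ≤ 1) (e : β) :
    ConnectsOn G (V(G) \ D) ({f ∈ E(G) | ∀ x ∈ D, ¬ G.Inc f x} \ {e}) where
  subset_edgeSet := fun f hf => hf.1.1
  ends_mem := fun f hf x hx => ⟨hx.vertex_mem, fun hxD => hf.1.2 x hxD hx⟩
  exists_isLink := by
    have hD2 : ∀ a, (insert a D).encard ≤ 2 := fun a => (Set.encard_insert_le _ _).trans (by
      calc D.encard + 1 ≤ 1 + 1 := by gcongr
        _ = 2 := by norm_num)
    have hmem : ∀ {f a b}, G.IsLink f a b → a ∉ D → b ∉ D → f ≠ e →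
        f ∈ {f ∈ E(G) | ∀ x ∈ D, ¬ G.Inc f x} \ {e} := by
      intro f a b hab ha hb hne
      refine ⟨⟨hab.edge_mem, fun x hxD hx => ?_⟩, hne⟩
      rcases hx.eq_or_eq_of_isLink hab with rfl | rfl
      exacts [ha hxD, hb hxD]
    intro W hW hWne hne
    obtain ⟨f, a, ha, b, hb, hab⟩ := hG.exists_isLink_of_cut hD
      (hD1.trans_lt (by norm_num)) hW hWne hne
    by_cases hfe : f = e
    swap
    · exact ⟨f, hmem hab (hW ha).2 hb.1.2 hfe, a, ha, b, hb, hab⟩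
    subst hfe
    have hba : b ≠ a := fun h => hb.2 (h ▸ ha)
    -- The crossing edge found is the deleted edge ab. If `W` has other vertices, deleting `a` as
    -- well forces a crossing edge that avoids `a`. If `W` is just {a}, a neighbour of `a` outside
    -- `D` and different from `b` is taken. Either way at most two vertices have to be avoided.
    by_cases hWa : (W \ {a}).Nonempty
    · obtain ⟨g, a', ha', b', hb', hab'⟩ := hG.exists_isLink_of_cut (D := insert a D)
        (Set.insert_subset (hW ha).1 hD) ((hD2 a).trans_lt (by norm_num)) (W := W \ {a})
        (fun y hy => ⟨(hW hy.1).1, by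
          rintro (h | h)
          exacts [hy.2 h, (hW hy.1).2 h]⟩) hWa
        (fun h => hb.2 (by
          have : b ∈ W \ {a} := h ▸ ⟨hb.1.1, by simp [hba, hb.1.2]⟩
          exact this.1))
      have hb'D : b' ≠ a ∧ b' ∉ D := by simpa using hb'.1.2
      refine ⟨g, hmem hab' (hW ha'.1).2 hb'D.2 ?_, a', ha'.1, b',
        ⟨⟨hb'.1.1, hb'D.2⟩, fun h => hb'.2 ⟨h, hb'D.1⟩⟩, hab'⟩
      rintro rfl
      rcases hab'.inc_left.eq_or_eq_of_isLink hab with h | h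
      · exact ha'.2 h
      · exact hb.2 (h ▸ ha'.1)
    · have hWa' : ∀ y ∈ W, y = a := fun y hy => by
        by_contra h
        exact hWa ⟨y, hy, h⟩
      obtain ⟨g, y, hy, hyD, hya⟩ := hG.exists_isLink_notMem (hW ha).1
        (D := insert b D) (Set.insert_subset hb.1.1 hD) (hD2 b)
        (by simp [hba.symm, (hW ha).2])
      have hyD' : y ≠ b ∧ y ∉ D := by simpa using hyD
      refine ⟨g, hmem hy (hW ha).2 hyD'.2 ?_, a, ha, y,
        ⟨⟨hy.right_mem, hyD'.2⟩, fun h => hya (hWa' y h)⟩, hy⟩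
      rintro rfl
      exact hyD'.1 (hy.right_unique hab)

theorem IsThreeConnected.connectsOn_deleteEdge (hG : IsThreeConnected G) (e : β) :
    ConnectsOn G V(G) (E(G) \ {e}) := by
  simpa [Set.sep_univ] using hG.connectsOn_sdiff (D := ∅) (by simp) (by simp) e

theorem IsThreeConnected.connectsOn_deleteVertex_deleteEdge (hG : IsThreeConnected G) {x : α}
    (hx : x ∈ V(G)) (e : β) : ConnectsOn G (V(G) \ {x}) ((E(G) \ G.incidenceSet x) \ {e}) := by
  have h := hG.connectsOn_sdiff (D := {x}) (by simpa using hx) (by simp) e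
  have : {f ∈ E(G) | ∀ y ∈ ({x} : Set α), ¬ G.Inc f y} = E(G) \ G.incidenceSet x := by
    ext f
    simp
  rwa [this] at h

theorem ConnectsOn.mono {U : Set α} {X Y : Set β} (h : ConnectsOn G U X) (hXY : X ⊆ Y)
    (hY : Y ⊆ E(G)) (hU : ∀ e ∈ Y, ∀ x, G.Inc e x → x ∈ U) : ConnectsOn G U Y where
  subset_edgeSet := hY
  ends_mem := hU
  exists_isLink W hW h1 h2 := by
    obtain ⟨e, he, h⟩ := h.exists_isLink W hW h1 h2
    exact ⟨e, hXY he, h⟩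

theorem IsThreeConnected.edgeSet_nonempty (hG : IsThreeConnected G) : E(G).Nonempty := by
  obtain ⟨x, hx, -⟩ := hG.not_vertexSet_subset (S := ∅) (by simp)
  obtain ⟨e, y, h, -⟩ := hG.exists_isLink_notMem hx (Set.empty_subset _) (by simp) (by simp)
  exact ⟨e, h.edge_mem⟩

theorem ends_mem_vertexSet_sdiff {x : α} {e : β} (he : e ∈ E(G) \ G.incidenceSet x) (y : α)
    (hy : G.Inc e y) : y ∈ V(G) \ {x} :=
  ⟨hy.vertex_mem, fun h => he.2 (by rw [← Set.mem_singleton_iff.1 h]; exact hy)⟩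

theorem IsThreeConnected.connectsOn_deleteVertex (hG : IsThreeConnected G) {x : α}
    (hx : x ∈ V(G)) : ConnectsOn G (V(G) \ {x}) (E(G) \ G.incidenceSet x) := by
  obtain ⟨e, -⟩ := hG.edgeSet_nonempty
  exact (hG.connectsOn_deleteVertex_deleteEdge hx e).mono Set.sdiff_subset Set.sdiff_subset
    fun f hf y hy => ends_mem_vertexSet_sdiff hf y hy

theorem IsThreeConnected.vertexSet_edgeInduce (hG : IsThreeConnected G) :
    V(edgeInduce G E(G)) = V(G) := by
  refine Set.Subset.antisymm (fun x ⟨e, _, hx⟩ => hx.vertex_mem) fun x hx => ?_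
  obtain ⟨e, y, h, -⟩ := hG.exists_isLink_notMem hx (Set.empty_subset _) (by simp) (by simp)
  exact ⟨e, h.edge_mem, h.inc_left⟩

theorem IsThreeConnected.vertexSet_edgeInduce_deleteVertex (hG : IsThreeConnected G) {x : α}
    (hx : x ∈ V(G)) : V(edgeInduce G (E(G) \ G.incidenceSet x)) = V(G) \ {x} := by
  refine Set.Subset.antisymm
    (fun y ⟨e, he, hy⟩ => ends_mem_vertexSet_sdiff he y hy) fun y hy => ?_
  obtain ⟨e, z, h, hz, -⟩ := hG.exists_isLink_notMem hy.1 (D := {x}) (by simpa using hx)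
    (by simp) hy.2
  refine ⟨e, ⟨h.edge_mem, fun hex => ?_⟩, h.inc_left⟩
  rcases Graph.Inc.eq_or_eq_of_isLink hex h with rfl | rfl
  exacts [hy.2 rfl, hz rfl]

/-- Every edge lies in a circuit if the excess is at least `k`. -/
theorem IsThreeConnected.cyclic (hG : IsThreeConnected G) (hV : V(G).Finite) (hE : E(G).Finite)
    (hk : 1 ≤ k) (hd : V(G).ncard + k ≤ E(G).ncard) :
    ∀ e ∈ E(G), ∃ C ∈ kCircuits G k, e ∈ C ∧ C ⊆ E(G) := by
  intro e he
  have h1 := Set.ncard_sdiff_singleton_add_one he hE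
  obtain ⟨C, hC, heC, -⟩ := (hG.connectsOn_deleteEdge e).exists_circuit hE hk hV (by omega) he
    (by simp) fun x hx => hx.vertex_mem
  exact ⟨C, hC, heC, hC.1⟩

/-- Every edge of `G - x` lies in a circuit of `G - x` if its excess is at least `k`. -/
theorem IsThreeConnected.cyclic_deleteVertex (hG : IsThreeConnected G) (hV : V(G).Finite)
    (hE : E(G).Finite) (hk : 1 ≤ k) {x : α} (hx : x ∈ V(G))
    (hd : (V(G) \ {x}).ncard + k ≤ (E(G) \ G.incidenceSet x).ncard) :
    ∀ e ∈ E(G) \ G.incidenceSet x,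
      ∃ C ∈ kCircuits G k, e ∈ C ∧ C ⊆ E(G) \ G.incidenceSet x := by
  intro e he
  have h1 := Set.ncard_sdiff_singleton_add_one he (hE.subset Set.sdiff_subset)
  obtain ⟨C, hC, heC, hCX⟩ := (hG.connectsOn_deleteVertex_deleteEdge hx e).exists_circuit hE hk
    (hV.subset Set.sdiff_subset) (by omega) he.1 (by simp)
    fun y hy => ends_mem_vertexSet_sdiff he y hy
  exact ⟨C, hC, heC, hCX.trans (by rw [Set.insert_sdiff_singleton, Set.insert_eq_of_mem he])⟩

theorem IsThreeConnected.ncard_base (hG : IsThreeConnected G) (hV : V(G).Finite)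
    (hE : E(G).Finite) (hk : 1 ≤ k) (hd : V(G).ncard + k ≤ E(G).ncard) {B : Set β}
    (hB : (kCircularMatroid G hE k hk).IsBase B) : B.ncard + 1 = V(G).ncard + k := by
  rw [← hG.vertexSet_edgeInduce]
  exact ncard_basis_of_cyclic hE hk hG.edgeSet_nonempty (hG.cyclic hV hE hk hd)
    hB.isBasis_ground

/-- The complement of a base has |E(G)| - (|V(G)| + k - 1) elements; the equation is written without
subtraction. -/
theorem IsThreeConnected.corank_add (hG : IsThreeConnected G) (hV : V(G).Finite)
    (hE : E(G).Finite) (hk : 1 ≤ k) (hd : V(G).ncard + k ≤ E(G).ncard) :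
    ∃ c : ℕ, corank G hE k hk = c ∧ c + V(G).ncard + k = E(G).ncard + 1 := by
  obtain ⟨B, hB⟩ := (kCircularMatroid G hE k hk).exists_isBase
  have h1 := hG.ncard_base hV hE hk hd hB
  have hBE : B ⊆ E(G) := hB.subset_ground
  have h2 := hB.compl_isBase_dual.encard_eq_eRank
  refine ⟨(E(G) \ B).ncard, ?_, ?_⟩
  · rw [corank, ← h2, kCircularMatroid_ground,
      (hE.subset Set.sdiff_subset).cast_ncard_eq]
  · have := Set.ncard_sdiff_add_ncard_of_subset hBE hE
    omega

/-- For a vertex x, the inequality says Δ(G - x) ≥ k, because G - x has |E(G)| - s(x) edges and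
|V(G)| - 1 vertices. -/
theorem IsThreeConnected.isKSmall_iff (hG : IsThreeConnected G) (hV : V(G).Finite)
    (hE : E(G).Finite) (hk : 1 ≤ k) (hd : V(G).ncard + k ≤ E(G).ncard) (x : α) :
    IsKSmall G hE k hk x ↔ (G.incidenceSet x).ncard + V(G).ncard + k ≤ E(G).ncard + 1 := by
  obtain ⟨c, hc, h⟩ := hG.corank_add hV hE hk hd
  rw [IsKSmall, hc, ← (hE.subset (G.incidenceSet_subset_edgeSet x)).cast_ncard_eq]
  norm_cast
  omega

/-- For a vertex x, the equation says Δ(G - x) = k - 1. -/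
theorem IsThreeConnected.isKTight_iff (hG : IsThreeConnected G) (hV : V(G).Finite)
    (hE : E(G).Finite) (hk : 1 ≤ k) (hd : V(G).ncard + k ≤ E(G).ncard) (x : α) :
    IsKTight G hE k hk x ↔ (G.incidenceSet x).ncard + V(G).ncard + k = E(G).ncard + 2 := by
  obtain ⟨c, hc, h⟩ := hG.corank_add hV hE hk hd
  rw [IsKTight, hc, ← (hE.subset (G.incidenceSet_subset_edgeSet x)).cast_ncard_eq]
  norm_cast
  omega

end ThreeConnected

end KCircular

namespace KCircular

/-! ### Sufficiency: recovering the stars from the matroid -/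

section Uniqueness

variable {α α' : Type u} {β : Type v} {G : Graph α β} {G' : Graph α' β} {k : ℕ}

/-- The set of ends of an edge determines which pairs it links, a loop being an edge with a single
end. So it suffices to match incidences. -/
theorem stronglyIsomorphic_of_inc_iff (hEE : E(G) = E(G')) (ν : V(G) ≃ V(G'))
    (h : ∀ e (x : V(G)), G.Inc e x ↔ G'.Inc e (ν x)) : StronglyIsomorphic G G' := by
  refine ⟨hEE, ν, fun e x y => ?_⟩
  rw [isLink_iff_inc, isLink_iff_inc, h, h]
  refine and_congr_right fun _ => and_congr_right fun _ => ⟨fun hz z hz' => ?_, fun hz z hz' => ?_⟩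
  · have h1 : G.Inc e (ν.symm ⟨z, hz'.vertex_mem⟩) := by
      rw [h, Equiv.apply_symm_apply]
      exact hz'
    rcases hz _ h1 with h2 | h2
    · left
      rw [← Subtype.ext h2, Equiv.apply_symm_apply]
    · right
      rw [← Subtype.ext h2, Equiv.apply_symm_apply]
  · have h1 := (h e ⟨z, hz'.vertex_mem⟩).1 hz'
    rcases hz _ h1 with h2 | h2
    · exact Or.inl (congrArg Subtype.val (ν.injective (Subtype.ext h2)))
    · exact Or.inr (congrArg Subtype.val (ν.injective (Subtype.ext h2)))

/-- Each vertex has a neighbour other than any given second vertex, hence an edge that is not at the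
latter. -/
theorem IsThreeConnected.incidenceSet_injOn (hG : IsThreeConnected G) :
    Set.InjOn G.incidenceSet V(G) := by
  intro x hx y hy hxy
  by_contra hne
  obtain ⟨e, z, he, hz, -⟩ := hG.exists_isLink_notMem hx (D := {y}) (by simpa using hy)
    (by simp) hne
  have hey : G.Inc e y := by
    have : e ∈ G.incidenceSet y := hxy ▸ he.inc_left
    exact this
  rcases hey.eq_or_eq_of_isLink he with h | h
  exacts [hne h.symm, hz h.symm]

/-- A graph with as many vertices as `G` in which every star of `G` is a star is isomorphic
to `G`. -/
theorem IsThreeConnected.stronglyIsomorphic_of_stars (hG : IsThreeConnected G)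
    (hEE : E(G) = E(G')) (hV' : V(G').Finite) (hcard : V(G').ncard = V(G).ncard)
    (hstar : ∀ x ∈ V(G), ∃ x' ∈ V(G'), G'.incidenceSet x' = G.incidenceSet x) :
    StronglyIsomorphic G G' := by
  have : Nonempty α' := by
    obtain ⟨x, hx, -⟩ := hG.not_vertexSet_subset (S := ∅) (by simp)
    exact ⟨(hstar x hx).choose⟩
  choose! f hfV hf using hstar
  have hinj : Set.InjOn f V(G) := fun x hx y hy h =>
    hG.incidenceSet_injOn hx hy (by rw [← hf x hx, ← hf y hy, h])
  have himg : f '' V(G) = V(G') :=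
    Set.eq_of_subset_of_ncard_le (Set.image_subset_iff.2 hfV)
      (by rw [hinj.ncard_image, hcard]) hV'
  have hbij : Set.BijOn f V(G) V(G') := ⟨hfV, hinj, himg.ge⟩
  refine stronglyIsomorphic_of_inc_iff hEE (hbij.equiv f) fun e x => ?_
  have := hf x.1 x.2
  rw [Set.ext_iff] at this
  exact (this e).symm

theorem edgeSet_eq_of_kCircularMatroid_eq {hE : E(G).Finite} {hE' : E(G').Finite} {hk : 1 ≤ k}
    (hM : kCircularMatroid G' hE' k hk = kCircularMatroid G hE k hk) : E(G') = E(G) := by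
  rw [← kCircularMatroid_ground G' hE' k hk, hM, kCircularMatroid_ground]

theorem kIndep_iff_of_kCircularMatroid_eq {hE : E(G).Finite} {hE' : E(G').Finite} {hk : 1 ≤ k}
    (hM : kCircularMatroid G' hE' k hk = kCircularMatroid G hE k hk) (I : Set β) :
    KIndep G' k I ↔ KIndep G k I := by
  rw [← kCircularMatroid_indep_iff G' hE' k hk, hM, kCircularMatroid_indep_iff]

theorem NoIsolatedVertex.vertexSet_edgeInduce (h : NoIsolatedVertex G) :
    V(edgeInduce G E(G)) = V(G) :=
  Set.Subset.antisymm (fun _ ⟨_, _, hx⟩ => hx.vertex_mem) fun x hx =>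
    (h x hx).imp fun _ he => ⟨he.edge_mem, he⟩

/-- Isolated vertices apart, `G'` has as many vertices as `G`. -/
theorem IsThreeConnected.ncard_vertexSet_eq (hG : IsThreeConnected G) (hV : V(G).Finite)
    (hE : E(G).Finite) (hE' : E(G').Finite) (hk : 1 ≤ k) (hd : V(G).ncard + k ≤ E(G).ncard)
    (hiso : NoIsolatedVertex G')
    (hM : kCircularMatroid G' hE' k hk = kCircularMatroid G hE k hk) :
    V(G').ncard = V(G).ncard := by
  rw [← hiso.vertexSet_edgeInduce, edgeSet_eq_of_kCircularMatroid_eq hM,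
    ncard_vertexSet_eq_of_cyclic hE hE' hk hM hG.edgeSet_nonempty (hG.cyclic hV hE hk hd),
    hG.vertexSet_edgeInduce]

/-- An edge set of size at least `|V(G)| - 1 + k` missing a vertex is dependent. -/
theorem KIndep.ncard_add_one_lt (hE : E(G).Finite) (hV : V(G).Finite) (hk : 1 ≤ k) {I : Set β}
    (hI : KIndep G k I) {x : α} (hx : x ∈ V(G)) (hxI : ∀ e ∈ I, ¬ G.Inc e x) :
    I.ncard + 1 < V(G).ncard + k := by
  have h1 := ((kIndep_iff hE hk).1 hI).2 I subset_rfl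
  rw [excess_edgeInduce hI.1] at h1
  have h2 : V(edgeInduce G I) ⊆ V(G) \ {x} := by
    rintro y ⟨e, he, hy⟩
    refine ⟨hy.vertex_mem, ?_⟩
    rintro rfl
    exact hxI e he hy
  have h3 := Set.ncard_le_ncard h2 (hV.subset Set.sdiff_subset)
  have h4 := Set.ncard_sdiff_singleton_add_one hx hV
  omega

/-- The star of a small vertex is a star in every graph with the same matroid. -/
theorem IsThreeConnected.exists_star_of_small (hG : IsThreeConnected G) (hV : V(G).Finite)
    (hE : E(G).Finite) (hV' : V(G').Finite) (hE' : E(G').Finite) (hk : 1 ≤ k)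
    (hd : V(G).ncard + k ≤ E(G).ncard) (hiso : NoIsolatedVertex G')
    (hM : kCircularMatroid G' hE' k hk = kCircularMatroid G hE k hk) {x : α} (hx : x ∈ V(G))
    (hs : (G.incidenceSet x).ncard + V(G).ncard + k ≤ E(G).ncard + 1) :
    ∃ x' ∈ V(G'), G'.incidenceSet x' = G.incidenceSet x := by
  have hcard := hG.ncard_vertexSet_eq hV hE hE' hk hd hiso hM
  have hEE := edgeSet_eq_of_kCircularMatroid_eq hM
  have h1 := Set.ncard_sdiff_add_ncard_of_subset (G.incidenceSet_subset_edgeSet x) hE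
  have h2 := Set.ncard_sdiff_singleton_add_one hx hV
  have hne : (E(G) \ G.incidenceSet x).Nonempty := by
    rw [← Set.ncard_pos (hE.subset Set.sdiff_subset)]
    omega
  have hcyc := hG.cyclic_deleteVertex hV hE hk hx (by omega)
  have h3 := ncard_vertexSet_eq_of_cyclic hE hE' hk hM hne hcyc
  rw [hG.vertexSet_edgeInduce_deleteVertex hx] at h3
  -- In G' the edges of G - x cover |V(G)| - 1 vertices, one fewer than G' has.
  obtain ⟨x', hx'V, hx'⟩ : ∃ x' ∈ V(G'), x' ∉ V(edgeInduce G' (E(G) \ G.incidenceSet x)) := by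
    by_contra! h
    have := Set.ncard_le_ncard h (vertexSet_edgeInduce_finite G' (hE.subset Set.sdiff_subset))
    omega
  have hsub : G'.incidenceSet x' ⊆ G.incidenceSet x := by
    intro e he
    by_contra hex
    exact hx' ⟨e, ⟨hEE ▸ Graph.Inc.edge_mem he, hex⟩, he⟩
  refine ⟨x', hx'V, hsub.antisymm fun e he => ?_⟩
  by_contra he'
  obtain ⟨B, hB⟩ := (kCircularMatroid G hE k hk).exists_isBasis (E(G) \ G.incidenceSet x)
    Set.sdiff_subset
  have h4 := ncard_basis_of_cyclic hE hk hne hcyc hB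
  rw [hG.vertexSet_edgeInduce_deleteVertex hx] at h4
  have heB : e ∉ B := fun h => (hB.subset h).2 he
  -- |B| = |V(G)| + k - 2, so this set has |V(G)| + k - 1 edges. It misses `x'` in G', where
  -- independent sets missing a vertex have at most |V(G)| + k - 2 edges.
  have hI : KIndep G k (insert e B) := KIndep.insert_of_new_end hE hk hB.indep he
    fun ⟨f, hf, hfx⟩ => (hB.subset hf).2 hfx
  have h5 := KIndep.ncard_add_one_lt hE' hV' hk ((kIndep_iff_of_kCircularMatroid_eq hM _).2 hI)
    hx'V (by
      rintro f (rfl | hf)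
      · exact he'
      · exact fun h => hx' ⟨f, hB.subset hf, h⟩)
  rw [Set.ncard_insert_of_notMem heB (hE.subset (hB.subset.trans Set.sdiff_subset))] at h5
  omega

/-- If all stars but that of a tight vertex `t` are stars of `G'`, then so is that of `t`. -/
theorem IsThreeConnected.exists_star_of_tight (hG : IsThreeConnected G) (hV : V(G).Finite)
    (hE : E(G).Finite) (hV' : V(G').Finite) (hE' : E(G').Finite) (hk : 1 ≤ k)
    (hcard : V(G').ncard = V(G).ncard)
    (hM : kCircularMatroid G' hE' k hk = kCircularMatroid G hE k hk) {t : α} (ht : t ∈ V(G))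
    (hs : (G.incidenceSet t).ncard + V(G).ncard + k = E(G).ncard + 2)
    (hstar : ∀ x ∈ V(G) \ {t}, ∃ x' ∈ V(G'), G'.incidenceSet x' = G.incidenceSet x) :
    ∃ t' ∈ V(G'), G'.incidenceSet t' = G.incidenceSet t := by
  have hEE := edgeSet_eq_of_kCircularMatroid_eq hM
  have h1 := Set.ncard_sdiff_add_ncard_of_subset (G.incidenceSet_subset_edgeSet t) hE
  have h2 := Set.ncard_sdiff_singleton_add_one ht hV
  have : Nonempty α' := by
    obtain ⟨x, -⟩ := (Set.ncard_pos hV').1 (by omega)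
    exact ⟨x⟩
  choose! f hfV hf using hstar
  have hinc : ∀ x ∈ V(G) \ {t}, ∀ e, G.Inc e x → G'.Inc e (f x) := fun x hx e he => by
    have : e ∈ G'.incidenceSet (f x) := hf x hx ▸ he
    exact this
  obtain ⟨t', ht'V, ht'⟩ : ∃ t' ∈ V(G'), t' ∉ f '' (V(G) \ {t}) := by
    by_contra! h
    have fV := hV.subset (Set.sdiff_subset (s := V(G)) (t := {t}))
    have h3 := Set.ncard_le_ncard h (fV.image f)
    have h4 := Set.ncard_image_le fV (f := f)
    omega
  have hsub : G'.incidenceSet t' ⊆ G.incidenceSet t := by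
    intro e he
    by_contra het
    have heE : e ∈ E(G) := hEE ▸ Graph.Inc.edge_mem he
    obtain ⟨x, y, hxy⟩ := G.exists_isLink_of_mem_edgeSet heE
    have hx := ends_mem_vertexSet_sdiff ⟨heE, het⟩ x hxy.inc_left
    have hy := ends_mem_vertexSet_sdiff ⟨heE, het⟩ y hxy.inc_right
    have := hG.1
    -- An edge at `t'` but not at `t` would have three distinct ends in G': `t'`, `f x` and `f y`.
    rcases Graph.Inc.eq_or_eq_or_eq he (hinc x hx e hxy.inc_left)
      (hinc y hy e hxy.inc_right) with h | h | h
    · exact ht' ⟨x, hx, h.symm⟩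
    · exact ht' ⟨y, hy, h.symm⟩
    · exact hxy.ne (hG.incidenceSet_injOn hx.1 hy.1 (by rw [← hf x hx, ← hf y hy, h]))
  refine ⟨t', ht'V, hsub.antisymm fun e he => ?_⟩
  by_contra he'
  -- Tightness makes G - t connected of excess exactly k - 1: it is independent, and with `e` it has
  -- the |V(G)| + k - 1 edges that are too many for a set missing `t'`.
  have hI : KIndep G k (insert e (E(G) \ G.incidenceSet t)) :=
    ((hG.connectsOn_deleteVertex ht).kIndep hE hk (by omega)).insert_of_new_end hE hk he
      fun ⟨g, hg, hgt⟩ => hg.2 hgt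
  have h5 := KIndep.ncard_add_one_lt hE' hV' hk ((kIndep_iff_of_kCircularMatroid_eq hM _).2 hI)
    ht'V (by
      rintro g (rfl | hg)
      · exact he'
      · exact fun h => hg.2 (hsub h))
  rw [Set.ncard_insert_of_notMem (fun h => h.2 he) (hE.subset Set.sdiff_subset)] at h5
  omega

/-- A graph with at most one vertex that is not small, and that one tight, is determined by its
`k`-circular matroid. -/
theorem IsThreeConnected.uniquelyDefined (hG : IsThreeConnected G) (hV : V(G).Finite)
    (hE : E(G).Finite) (hk : 1 ≤ k) (hd : V(G).ncard + k ≤ E(G).ncard)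
    (h : (∀ x ∈ V(G), IsKSmall G hE k hk x) ∨
      ∃ t ∈ V(G), IsKTight G hE k hk t ∧ ∀ x ∈ V(G), x ≠ t → IsKSmall G hE k hk x) :
    UniquelyDefined G hE k hk := by
  intro α' G' hV' hE' hiso hM
  have hcard := hG.ncard_vertexSet_eq hV hE hE' hk hd hiso hM
  have hsmall : ∀ x ∈ V(G), IsKSmall G hE k hk x →
      ∃ x' ∈ V(G'), G'.incidenceSet x' = G.incidenceSet x := fun x hx hs =>
    hG.exists_star_of_small hV hE hV' hE' hk hd hiso hM hx
      ((hG.isKSmall_iff hV hE hk hd x).1 hs)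
  refine hG.stronglyIsomorphic_of_stars (edgeSet_eq_of_kCircularMatroid_eq hM).symm hV' hcard ?_
  rcases h with h | ⟨t, ht, htight, h⟩
  · exact fun x hx => hsmall x hx (h x hx)
  · intro x hx
    by_cases hxt : x = t
    · subst hxt
      exact hG.exists_star_of_tight hV hE hV' hE' hk hcard hM hx
        ((hG.isKTight_iff hV hE hk hd x).1 htight)
        fun y hy => hsmall y hy.1 (h y hy.1 hy.2)
    · exact hsmall x hx (h x hx hxt)

end Uniqueness

end KCircular

namespace KCircular

/-! ### Necessity: changing the graph without changing the matroid -/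

section Modifications

variable {α : Type u} {β : Type v} {G G' : Graph α β} {k : ℕ}

/-- Replace the ends of the edge `e` by `a` and `b`. -/
def relink (G : Graph α β) (e : β) (a b : α) (he : e ∈ E(G)) (ha : a ∈ V(G)) (hb : b ∈ V(G)) :
    Graph α β where
  vertexSet := V(G)
  edgeSet := E(G)
  IsLink f x y := (f ≠ e ∧ G.IsLink f x y) ∨ (f = e ∧ (x = a ∧ y = b ∨ x = b ∧ y = a))
  isLink_symm _ _ := ⟨fun x y h => by
    rcases h with ⟨h1, h2⟩ | ⟨h1, h2⟩
    · exact Or.inl ⟨h1, h2.symm⟩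
    · exact Or.inr ⟨h1, by tauto⟩⟩
  eq_or_eq_of_isLink_of_isLink f x y z w h h' := by
    rcases h with ⟨h1, h2⟩ | ⟨h1, h2⟩ <;> rcases h' with ⟨h3, h4⟩ | ⟨h3, h4⟩
    · exact h2.left_eq_or_eq h4
    · exact absurd h3 h1
    · exact absurd h1 h3
    · rcases h2 with ⟨rfl, rfl⟩ | ⟨rfl, rfl⟩ <;> rcases h4 with ⟨rfl, rfl⟩ | ⟨rfl, rfl⟩ <;> simp
  edge_mem_iff_exists_isLink f := by
    constructor
    · intro hf
      by_cases hfe : f = e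
      · exact ⟨a, b, Or.inr ⟨hfe, Or.inl ⟨rfl, rfl⟩⟩⟩
      · obtain ⟨x, y, h⟩ := G.exists_isLink_of_mem_edgeSet hf
        exact ⟨x, y, Or.inl ⟨hfe, h⟩⟩
    · rintro ⟨x, y, ⟨-, h⟩ | ⟨rfl, -⟩⟩
      exacts [h.edge_mem, he]
  left_mem_of_isLink f x y h := by
    rcases h with ⟨-, h⟩ | ⟨-, ⟨rfl, -⟩ | ⟨rfl, -⟩⟩
    exacts [h.left_mem, ha, hb]

theorem relink_isLink_of_ne {e f : β} {a b x y : α} (he : e ∈ E(G)) (ha : a ∈ V(G))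
    (hb : b ∈ V(G)) (hf : f ≠ e) : (relink G e a b he ha hb).IsLink f x y ↔ G.IsLink f x y := by
  simp [relink, hf]

theorem relink_inc_of_ne {e f : β} {a b x : α} (he : e ∈ E(G)) (ha : a ∈ V(G))
    (hb : b ∈ V(G)) (hf : f ≠ e) : (relink G e a b he ha hb).Inc f x ↔ G.Inc f x := by
  simp [Graph.Inc, relink_isLink_of_ne he ha hb hf]

theorem relink_inc_self {e : β} {a b x : α} (he : e ∈ E(G)) (ha : a ∈ V(G))
    (hb : b ∈ V(G)) : (relink G e a b he ha hb).Inc e x ↔ x = a ∨ x = b := by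
  constructor
  · rintro ⟨y, ⟨h, -⟩ | ⟨-, h⟩⟩
    · exact absurd rfl h
    · tauto
  · rintro (rfl | rfl)
    · exact ⟨b, Or.inr ⟨rfl, Or.inl ⟨rfl, rfl⟩⟩⟩
    · exact ⟨a, Or.inr ⟨rfl, Or.inr ⟨rfl, rfl⟩⟩⟩

/-- The same edges are counted in both graphs, so only the covered vertices matter. Both
modifications are compared with the original in this way. -/
theorem excess_le_of_vertexSet_subset {X : Set β} (hX : X ⊆ E(G)) (hX' : X ⊆ E(G'))
    (fX : X.Finite) (h : V(edgeInduce G' X) ⊆ V(edgeInduce G X)) :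
    excess (edgeInduce G X) ≤ excess (edgeInduce G' X) := by
  rw [excess_edgeInduce hX, excess_edgeInduce hX']
  have := Set.ncard_le_ncard h (vertexSet_edgeInduce_finite G fX)
  omega

theorem kCircularMatroid_eq_of_kIndep_iff (hE : E(G).Finite) (hE' : E(G').Finite) (hk : 1 ≤ k)
    (hEE : E(G') = E(G)) (h : ∀ I, KIndep G' k I ↔ KIndep G k I) :
    kCircularMatroid G' hE' k hk = kCircularMatroid G hE k hk :=
  Matroid.ext_indep hEE fun I _ => h I

theorem StronglyIsomorphic.exists_star (h : StronglyIsomorphic G G') {x : α} (hx : x ∈ V(G)) :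
    ∃ x' ∈ V(G'), ∀ e, G'.Inc e x' ↔ G.Inc e x := by
  obtain ⟨-, ν, hν⟩ := h
  refine ⟨ν ⟨x, hx⟩, (ν ⟨x, hx⟩).2, fun e => ⟨fun ⟨y, hy⟩ => ?_, fun ⟨y, hy⟩ => ?_⟩⟩
  · refine ⟨ν.symm ⟨y, hy.right_mem⟩, (hν e ⟨x, hx⟩ _).2 ?_⟩
    rwa [Equiv.apply_symm_apply]
  · exact ⟨_, (hν e ⟨x, hx⟩ ⟨y, hy.right_mem⟩).1 hy⟩

/-- If `G - x` has excess at most `k - 2`, an edge `xy` can be replaced by a loop at `y`. -/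
theorem IsThreeConnected.not_uniquelyDefined_of_big (hG : IsThreeConnected G) (hV : V(G).Finite)
    (hE : E(G).Finite) (hk : 1 ≤ k) {x : α} (hx : x ∈ V(G))
    (hd : E(G).ncard + 2 < (G.incidenceSet x).ncard + V(G).ncard + k) :
    ¬ UniquelyDefined G hE k hk := by
  have h1 := Set.ncard_sdiff_add_ncard_of_subset (G.incidenceSet_subset_edgeSet x) hE
  have h2 := Set.ncard_sdiff_singleton_add_one hx hV
  obtain ⟨e, y, hxy, -, hyx⟩ := hG.exists_isLink_notMem hx (Set.empty_subset _) (by simp)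
    (by simp)
  have he := hxy.edge_mem
  have hy := hxy.right_mem
  let G' := relink G e y y he hy hy
  have hEE : E(G') = E(G) := rfl
  have hVV : V(G') = V(G) := rfl
  have hoff : ∀ f z, f ≠ e → (G'.Inc f z ↔ G.Inc f z) := fun f z hf =>
    relink_inc_of_ne he hy hy hf
  have hloop : G'.IsLoopAt e y := Or.inr ⟨rfl, Or.inl ⟨rfl, rfl⟩⟩
  clear_value G'
  have hinc : ∀ f z, G'.Inc f z → G.Inc f z := by
    intro f z h
    by_cases hf : f = e
    · subst hf
      exact hloop.eq_of_inc h ▸ hxy.inc_right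
    · exact (hoff f z hf).1 h
  have hinc' : ∀ f z, G.Inc f z → ¬ G'.Inc f z → f = e ∧ z = x := by
    intro f z h h'
    by_cases hf : f = e
    · subst hf
      refine ⟨rfl, (h.eq_or_eq_of_isLink hxy).resolve_right fun hz => h' ?_⟩
      exact hz ▸ hloop.inc
    · exact absurd ((hoff f z hf).2 h) h'
  intro hU
  have hiso : NoIsolatedVertex G' := by
    intro z hz
    rw [hVV] at hz
    by_cases hzx : z = x
    · subst hzx
      obtain ⟨f, w, hw, hwy, -⟩ := hG.exists_isLink_notMem hx (D := {y}) (by simpa using hy)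
        (by simp) hyx.symm
      have hfe : f ≠ e := by
        rintro rfl
        exact hwy (hw.right_unique hxy)
      exact ⟨f, (hoff f _ hfe).2 hw.inc_left⟩
    · obtain ⟨f, w, hw, -⟩ := hG.exists_isLink_notMem hz (Set.empty_subset _) (by simp) (by simp)
      refine ⟨f, ?_⟩
      by_contra h
      exact hzx (hinc' f z hw.inc_left h).2
  have hE' : E(G').Finite := hEE ▸ hE
  have hM : kCircularMatroid G' hE' k hk = kCircularMatroid G hE k hk := by
    refine kCircularMatroid_eq_of_kIndep_iff hE hE' hk hEE fun I => ?_
    rw [kIndep_iff hE' hk, kIndep_iff hE hk]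
    rw [hEE]
    refine and_congr_right fun hIE => forall₂_congr fun X hXI => ?_
    have hXE : X ⊆ E(G) := hXI.trans hIE
    have hXE' : X ⊆ E(G') := hEE ▸ hXE
    have fX := hE.subset hXE
    refine ⟨(excess_le_of_vertexSet_subset hXE hXE' fX ?_).trans_lt, fun hX => ?_⟩
    · rintro z ⟨f, hf, hz⟩
      exact ⟨f, hf, hinc f z hz⟩
    by_cases hsub : V(edgeInduce G X) ⊆ V(edgeInduce G' X)
    · exact (excess_le_of_vertexSet_subset hXE' hXE fX hsub).trans_lt hX
    -- Only `x` can be lost, and then `X` without the loop lies in G - x. There nonempty sets have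
    -- excess at most k - 2, and the loop adds at most 1.
    obtain ⟨z, ⟨g, hgX, hgz⟩, hz⟩ := Set.not_subset.1 hsub
    obtain ⟨rfl, rfl⟩ := hinc' g z hgz fun h => hz ⟨g, hgX, h⟩
    have hX1 : X \ {g} ⊆ E(G) \ G.incidenceSet z := by
      intro f hf
      refine ⟨hXE hf.1, fun hfz => hz ⟨f, hf.1, ?_⟩⟩
      exact (hoff f _ hf.2).2 hfz
    have hV1 : V(edgeInduce G (X \ {g})) ⊆ V(edgeInduce G' X) := by
      rintro w ⟨f, hf, hw⟩
      exact ⟨f, hf.1, (hoff f _ hf.2).2 hw⟩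
    have h3 := Set.ncard_sdiff_singleton_add_one hgX fX
    have h4 := Set.ncard_le_ncard hV1 (vertexSet_edgeInduce_finite G' fX)
    rw [excess_edgeInduce hXE']
    -- The empty set has excess 0, which exceeds k - 2 when k = 1. The loop alone has excess 0,
    -- which is less than k.
    rcases (X \ {g}).eq_empty_or_nonempty with h0 | hne
    · have hyX : y ∈ V(edgeInduce G' X) :=
        ⟨g, hgX, hloop.inc⟩
      have := (Set.ncard_pos (vertexSet_edgeInduce_finite G' fX)).2 ⟨y, hyX⟩
      rw [h0, Set.ncard_empty] at h3
      omega
    · have h5 := (hG.connectsOn_deleteVertex hx).excess_le hE hX1 hne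
      rw [excess_edgeInduce (hX1.trans Set.sdiff_subset)] at h5
      omega
  obtain ⟨-, ν, hν⟩ := hU α G' (hVV ▸ hV) hE' hiso hM
  have := hG.1
  -- A strong isomorphism would carry the loop of `G'` back to a loop of the loopless G.
  have h3 := (hν e (ν.symm ⟨y, hVV ▸ hy⟩) (ν.symm ⟨y, hVV ▸ hy⟩)).2 (by
    rw [Equiv.apply_symm_apply]
    exact hloop)
  exact h3.ne rfl

/-- If every dependent set of `G` covers `x₁` and `x₂`, and `G'` differs from `G` only at `x₁` and
`x₂`, then independent sets of `G'` are independent in `G`. -/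
theorem KIndep.of_ends_off_pair (hE : E(G).Finite) (hk : 1 ≤ k) (hEE : E(G') = E(G)) {x₁ x₂ : α}
    (h₁ : ∀ X ⊆ E(G) \ G.incidenceSet x₁, excess (edgeInduce G X) < k)
    (h₂ : ∀ X ⊆ E(G) \ G.incidenceSet x₂, excess (edgeInduce G X) < k)
    (hinc : ∀ f z, z ≠ x₁ → z ≠ x₂ → G'.Inc f z → G.Inc f z) {I : Set β} (hI : KIndep G' k I) :
    KIndep G k I := by
  rw [kIndep_iff (hEE ▸ hE) hk] at hI
  rw [kIndep_iff hE hk]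
  refine ⟨hEE ▸ hI.1, fun X hX => ?_⟩
  have hXE : X ⊆ E(G) := hX.trans (hEE ▸ hI.1)
  by_contra hcon
  have hmem : ∀ x, (∀ X ⊆ E(G) \ G.incidenceSet x, excess (edgeInduce G X) < k) →
      x ∈ V(edgeInduce G X) := fun x h => by
    by_contra hx
    exact hcon (h X fun f hf => ⟨hXE hf, fun hfx => hx ⟨f, hf, hfx⟩⟩)
  -- A set of excess at least k in G covers `x₁` and `x₂`, the only places where `G'` could cover
  -- more; so its excess in `G'` is no smaller.
  refine hcon ((excess_le_of_vertexSet_subset hXE (hX.trans hI.1) (hE.subset hXE) ?_).trans_lt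
    (hI.2 X hX))
  rintro z ⟨f, hf, hz⟩
  by_cases hz1 : z = x₁
  · exact hz1 ▸ hmem x₁ h₁
  by_cases hz2 : z = x₂
  · exact hz2 ▸ hmem x₂ h₂
  exact ⟨f, hf, hinc f z hz1 hz2 hz⟩

/-- Exchanging an edge `e` of the star of `x` for another edge `e'` keeps the graph without `x`
independent. -/
theorem IsThreeConnected.excess_lt_of_exchange (hG : IsThreeConnected G) (hV : V(G).Finite)
    (hE : E(G).Finite) (hk : 1 ≤ k) (hEE : E(G') = E(G)) (hVV : V(G') = V(G)) {x : α}
    (hx : x ∈ V(G)) (hd : E(G).ncard + 1 < (G.incidenceSet x).ncard + V(G).ncard + k) {e e' : β}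
    (he : G.Inc e x) (he'E : e' ∈ E(G)) (he' : ¬ G.Inc e' x) (hex : ¬ G'.Inc e x)
    (he'x : G'.Inc e' x) (hlink : ∀ f, f ≠ e → f ≠ e' → ∀ a b, G'.IsLink f a b ↔ G.IsLink f a b)
    {X : Set β} (hX : X ⊆ E(G') \ G'.incidenceSet x) : excess (edgeInduce G' X) < k := by
  have hinc : ∀ f, f ≠ e → f ≠ e' → ∀ a, G'.Inc f a ↔ G.Inc f a := fun f h1 h2 a =>
    exists_congr fun b => hlink f h1 h2 a b
  set Y := (E(G) \ G.incidenceSet x) \ {e'} with hY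
  have hYe : e ∉ Y := fun h => h.1.2 he
  have hYne : ∀ f ∈ Y, f ≠ e ∧ f ≠ e' := fun f hf => ⟨fun h => hYe (h ▸ hf), hf.2⟩
  have hc := hG.connectsOn_deleteVertex_deleteEdge hx e'
  have hc' : ConnectsOn G' (V(G) \ {x}) Y :=
    { subset_edgeSet := hEE ▸ hc.subset_edgeSet
      ends_mem := fun f hf y hy =>
        hc.ends_mem f hf y ((hinc f (hYne f hf).1 (hYne f hf).2 y).1 hy)
      exists_isLink := fun W hW h1 h2 => by
        obtain ⟨f, hf, a, ha, b, hb, hab⟩ := hc.exists_isLink W hW h1 h2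
        exact ⟨f, hf, a, ha, b, hb, (hlink f (hYne f hf).1 (hYne f hf).2 a b).2 hab⟩ }
  -- G' - x arises from G - x by losing `e'` and gaining `e`. Since G - x - e' is already connected,
  -- G' - x is connected with the same excess, at most k - 1.
  have hc'' := hc'.insert_edge (e := e) (hEE ▸ he.edge_mem) fun y hy =>
    ⟨hVV ▸ hy.vertex_mem, fun h => hex (by rw [← Set.mem_singleton_iff.1 h]; exact hy)⟩
  have h1 := Set.ncard_sdiff_add_ncard_of_subset (G.incidenceSet_subset_edgeSet x) hE
  have h2 := Set.ncard_sdiff_singleton_add_one hx hV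
  have fS : (E(G) \ G.incidenceSet x).Finite := hE.subset Set.sdiff_subset
  have he'S : e' ∈ E(G) \ G.incidenceSet x := ⟨he'E, he'⟩
  have h3 := Set.ncard_sdiff_singleton_add_one he'S fS
  rw [← hY] at h3
  refine hc''.excess_lt (hEE ▸ hE) hk ?_ fun f hf => ?_
  · rw [Set.ncard_insert_of_notMem hYe (fS.subset Set.sdiff_subset)]
    omega
  · by_cases hfe : f = e
    · exact Or.inl hfe
    have hfne : f ≠ e' := by
      rintro rfl
      exact (hX hf).2 he'x
    exact Or.inr ⟨⟨hEE ▸ (hX hf).1, fun h => (hX hf).2 ((hinc f hfe hfne x).2 h)⟩, hfne⟩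

/-- If two vertices are not small, an edge of one star can be exchanged for an edge of the other. -/
theorem IsThreeConnected.not_uniquelyDefined_of_pair (hG : IsThreeConnected G) (hV : V(G).Finite)
    (hE : E(G).Finite) (hk : 1 ≤ k) {x₁ x₂ : α} (hx₁ : x₁ ∈ V(G)) (hx₂ : x₂ ∈ V(G))
    (hne : x₁ ≠ x₂) (hd₁ : E(G).ncard + 1 < (G.incidenceSet x₁).ncard + V(G).ncard + k)
    (hd₂ : E(G).ncard + 1 < (G.incidenceSet x₂).ncard + V(G).ncard + k) :
    ¬ UniquelyDefined G hE k hk := by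
  obtain ⟨e₁, y₁, h₁, hy₁', hy₁⟩ := hG.exists_isLink_notMem hx₁ (D := {x₂}) (by simpa using hx₂)
    (by simp) hne
  obtain ⟨e₂, y₂, h₂, hy₂', hy₂⟩ := hG.exists_isLink_notMem hx₂ (D := {x₁}) (by simpa using hx₁)
    (by simp) hne.symm
  rw [Set.mem_singleton_iff] at hy₁' hy₂'
  have he₂x₁ : ¬ G.Inc e₂ x₁ := fun h => by
    rcases h.eq_or_eq_of_isLink h₂ with h | h
    exacts [hne h, hy₂' h.symm]
  have he₁x₂ : ¬ G.Inc e₁ x₂ := fun h => by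
    rcases h.eq_or_eq_of_isLink h₁ with h | h
    exacts [hne h.symm, hy₁' h.symm]
  have hee : e₁ ≠ e₂ := by
    rintro rfl
    exact he₂x₁ h₁.inc_left
  -- `e₁` = x₁y₁ becomes x₂y₁, and then `e₂` = x₂y₂ becomes x₁y₂; y₁ and y₂ may coincide.
  let G₁ := relink G e₁ x₂ y₁ h₁.edge_mem hx₂ h₁.right_mem
  have he₂ : e₂ ∈ E(G₁) := h₂.edge_mem
  have hy₂V : y₂ ∈ V(G₁) := h₂.right_mem
  let G' := relink G₁ e₂ x₁ y₂ he₂ hx₁ hy₂V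
  have hlink : ∀ f, f ≠ e₁ → f ≠ e₂ → ∀ a b, G'.IsLink f a b ↔ G.IsLink f a b :=
    fun f hf₁ hf₂ a b => (relink_isLink_of_ne he₂ hx₁ hy₂V hf₂).trans
      (relink_isLink_of_ne h₁.edge_mem hx₂ h₁.right_mem hf₁)
  have hinc : ∀ f, f ≠ e₁ → f ≠ e₂ → ∀ a, G'.Inc f a ↔ G.Inc f a := fun f hf₁ hf₂ a =>
    exists_congr fun b => hlink f hf₁ hf₂ a b
  have hinc₁ : ∀ a, G'.Inc e₁ a ↔ a = x₂ ∨ a = y₁ := fun a =>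
    (relink_inc_of_ne he₂ hx₁ hy₂V hee).trans
      (relink_inc_self h₁.edge_mem hx₂ h₁.right_mem)
  have hinc₂ : ∀ a, G'.Inc e₂ a ↔ a = x₁ ∨ a = y₂ := fun a => relink_inc_self he₂ hx₁ hy₂V
  have hEE : E(G') = E(G) := rfl
  have hVV : V(G') = V(G) := rfl
  clear_value G'
  have hoff : ∀ f z, z ≠ x₁ → z ≠ x₂ → (G'.Inc f z ↔ G.Inc f z) := by
    intro f z hz₁ hz₂
    by_cases hf₁ : f = e₁
    · subst hf₁
      rw [hinc₁]
      refine ⟨fun h => ?_, fun h => Or.inr ((h.eq_or_eq_of_isLink h₁).resolve_left hz₁)⟩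
      rw [h.resolve_left hz₂]
      exact h₁.inc_right
    by_cases hf₂ : f = e₂
    · subst hf₂
      rw [hinc₂]
      refine ⟨fun h => ?_, fun h => Or.inr ((h.eq_or_eq_of_isLink h₂).resolve_left hz₂)⟩
      rw [h.resolve_left hz₁]
      exact h₂.inc_right
    exact hinc f hf₁ hf₂ z
  have he₁x₁' : ¬ G'.Inc e₁ x₁ := fun h => by
    rcases (hinc₁ x₁).1 h with h | h
    exacts [hne h, hy₁ h.symm]
  have he₂x₂' : ¬ G'.Inc e₂ x₂ := fun h => by
    rcases (hinc₂ x₂).1 h with h | h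
    exacts [hne h.symm, hy₂ h.symm]
  have he₁x₂' : G'.Inc e₁ x₂ := (hinc₁ x₂).2 (Or.inl rfl)
  have he₂x₁' : G'.Inc e₂ x₁ := (hinc₂ x₁).2 (Or.inl rfl)
  intro hU
  have hiso : NoIsolatedVertex G' := by
    intro z hz
    rw [hVV] at hz
    by_cases hz₁ : z = x₁
    · exact ⟨e₂, hz₁ ▸ he₂x₁'⟩
    by_cases hz₂ : z = x₂
    · exact ⟨e₁, hz₂ ▸ he₁x₂'⟩
    obtain ⟨f, w, hw, -⟩ := hG.exists_isLink_notMem hz (Set.empty_subset _) (by simp) (by simp)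
    exact ⟨f, (hoff f z hz₁ hz₂).2 hw.inc_left⟩
  have hexc : ∀ x ∈ V(G), E(G).ncard + 1 < (G.incidenceSet x).ncard + V(G).ncard + k →
      ∀ X ⊆ E(G) \ G.incidenceSet x, excess (edgeInduce G X) < k := by
    intro x hx hd X hX
    have h3 := Set.ncard_sdiff_add_ncard_of_subset (G.incidenceSet_subset_edgeSet x) hE
    have h4 := Set.ncard_sdiff_singleton_add_one hx hV
    exact (hG.connectsOn_deleteVertex hx).excess_lt hE hk (by omega) hX
  have hE' : E(G').Finite := hEE ▸ hE
  have hM : kCircularMatroid G' hE' k hk = kCircularMatroid G hE k hk := by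
    refine kCircularMatroid_eq_of_kIndep_iff hE hE' hk hEE fun I =>
      ⟨fun hI => ?_, fun hI => ?_⟩
    · exact hI.of_ends_off_pair hE hk hEE (hexc x₁ hx₁ hd₁) (hexc x₂ hx₂ hd₂)
        fun f z hz₁ hz₂ => (hoff f z hz₁ hz₂).1
    · exact hI.of_ends_off_pair hE' hk hEE.symm
        (fun X hX => hG.excess_lt_of_exchange hV hE hk hEE hVV hx₁ hd₁ h₁.inc_left h₂.edge_mem
          he₂x₁ he₁x₁' he₂x₁' hlink hX)
        (fun X hX => hG.excess_lt_of_exchange hV hE hk hEE hVV hx₂ hd₂ h₂.inc_left h₁.edge_mem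
          he₁x₂ he₂x₂' he₁x₂' (fun f hf₂ hf₁ => hlink f hf₁ hf₂) hX)
        fun f z hz₁ hz₂ => (hoff f z hz₁ hz₂).2
  obtain ⟨v, -, hv⟩ := (hU α G' (hVV ▸ hV) hE' hiso hM).exists_star hx₁
  -- A vertex of `G'` whose star is that of x₁ in G would be an end of `e₁`, that is x₂ or y₁, and
  -- also an end of the unchanged edge `f`, which avoids both.
  obtain ⟨f, z, hz, hzD, -⟩ := hG.exists_isLink_notMem hx₁ (D := {x₂, y₁})
    (Set.insert_subset hx₂ (by simpa using h₁.right_mem)) (Set.encard_pair (Ne.symm hy₁')).le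
    (by simp [hne, hy₁.symm])
  have hzD' : z ≠ x₂ ∧ z ≠ y₁ := by simpa using hzD
  have hfe₁ : f ≠ e₁ := by
    rintro rfl
    exact hzD'.2 (hz.right_unique h₁)
  have hfe₂ : f ≠ e₂ := by
    rintro rfl
    exact he₂x₁ hz.inc_left
  have hfv := (hinc f hfe₁ hfe₂ v).1 ((hv f).2 hz.inc_left)
  rcases (hinc₁ v).1 ((hv e₁).2 h₁.inc_left) with rfl | rfl
  · rcases hfv.eq_or_eq_of_isLink hz with h | h
    exacts [hne h.symm, hzD'.1 h.symm]
  · rcases hfv.eq_or_eq_of_isLink hz with h | h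
    exacts [hy₁ h, hzD'.2 h.symm]

theorem IsThreeConnected.two_le_ncard_incidenceSet (hG : IsThreeConnected G) (hE : E(G).Finite)
    {x : α} (hx : x ∈ V(G)) : 2 ≤ (G.incidenceSet x).ncard := by
  obtain ⟨e, y, hy, -, hyx⟩ := hG.exists_isLink_notMem hx (Set.empty_subset _) (by simp) (by simp)
  obtain ⟨f, z, hz, hzy, -⟩ := hG.exists_isLink_notMem hx (D := {y})
    (by simpa using hy.right_mem) (by simp) hyx.symm
  have hef : e ≠ f := by
    rintro rfl
    exact hzy (hz.right_unique hy)
  rw [← Set.ncard_pair hef]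
  refine Set.ncard_le_ncard ?_ (hE.subset (G.incidenceSet_subset_edgeSet x))
  rintro g (rfl | rfl)
  exacts [hy.inc_left, hz.inc_left]

end Modifications

end KCircular

/-! ### The equivalence -/

theorem mainTheorem1 {α : Type u} {β : Type v} (G : Graph α β) (hV : V(G).Finite)
    (hE : E(G).Finite) (hG : KCircular.IsThreeConnected G) (k : ℕ) (hk : 1 ≤ k) :
    KCircular.UniquelyDefined G hE k hk ↔
      ((k : ℤ) ≤ (E(G).ncard : ℤ) - (V(G).ncard : ℤ) ∧
        ((∀ x ∈ V(G), KCircular.IsKSmall G hE k hk x) ∨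
          ∃ t ∈ V(G), KCircular.IsKTight G hE k hk t ∧
            ∀ x ∈ V(G), x ≠ t → KCircular.IsKSmall G hE k hk x)) := by
  refine ⟨fun hU => ?_, fun ⟨hd, h⟩ => hG.uniquelyDefined hV hE hk (by omega) h⟩
  have hnotBig : ∀ x ∈ V(G), (G.incidenceSet x).ncard + V(G).ncard + k ≤ E(G).ncard + 2 := by
    intro x hx
    by_contra h
    exact hG.not_uniquelyDefined_of_big hV hE hk hx (not_le.1 h) hU
  -- Δ(G) = Δ(G - x) + s(x) - 1 with Δ(G - x) ≥ k - 1 and s(x) ≥ 2, so the loop construction already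
  -- excludes Δ(G) < k.
  have hd : V(G).ncard + k ≤ E(G).ncard := by
    obtain ⟨x, hx, -⟩ := hG.not_vertexSet_subset (S := ∅) (by simp)
    have h1 := hnotBig x hx
    have h2 := hG.two_le_ncard_incidenceSet hE hx
    omega
  have hsmall := hG.isKSmall_iff hV hE hk hd
  have htight := hG.isKTight_iff hV hE hk hd
  refine ⟨by omega, or_iff_not_imp_left.2 fun h => ?_⟩
  push Not at h
  obtain ⟨t, ht, hts⟩ := h
  rw [hsmall, not_le] at hts
  -- Not small gives Δ(G - t) ≤ k - 1 and `hnotBig` gives the reverse inequality; a second vertex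
  -- that is not small would permit the exchange.
  refine ⟨t, ht, (htight t).2 (by have := hnotBig t ht; omega), fun x hx hxt => ?_⟩
  rw [hsmall]
  by_contra hxs
  exact hG.not_uniquelyDefined_of_pair hV hE hk hx ht hxt (not_le.1 hxs) hts hU
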